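/- Let $K$ be an algebraically closed field of characteristic $0$, let $n_1,\dots,n_k\ge 1$ and let $S=S_1\oplus\dots\oplus S_k$ with $S_i=M_{n_i}(K)$ and matrix units $e^i_{uv}$. Let $\mathbb{D}\mathrm{er}(S)=\mathrm{Der}(S,S\otimes S)$ be the space of double derivations (derivations for the outer bimodule structure $s\cdot(x'\otimes x'')\cdot t=sx'\otimes x''t$), an $S$-bimodule through the inner action $(s\delta t)(x)=\delta(x)'t\otimes s\,\delta(x)''$. Let $\mathbb{D}S=T_S\,\mathbb{D}\mathrm{er}(S)$ be its tensor algebra over $S$, graded with $S$ in degree $0$ and $\mathbb{D}\mathrm{er}(S)$ in degree $1$. Let $\{\!\{-,-\}\!\}$ be the double Schouten bracket on $\mathbb{D}S$, that is, the bilinear map $\mathbb{D}S\times\mathbb{D}S\to\mathbb{D}S\otimes\mathbb{D}S$ determined by $\{\!\{s,t\}\!\}=0$, $\{\!\{\delta,s\}\!\}=\delta(s)$ and $$\{\!\{\delta,\Delta\}\!\}=\tau_{(23)}\big((\delta\otimes1)\Delta-(1\otimes\Delta)\delta\big)+\tau_{(12)}\big((1\otimes\delta)\Delta-(\Delta\otimes1)\delta\big)\in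 \mathbb{D}\mathrm{er}(S)\otimes S\,\oplus\, S\otimes\mathbb{D}\mathrm{er}(S)$$ for $s,t\in S$ and $\delta,\Delta\in\mathbb{D}\mathrm{er}(S)$, by $\{\!\{\alpha,\beta\gamma\}\!\}=(-1)^{(|\alpha|-1)|\beta|}\beta\{\!\{\alpha,\gamma\}\!\}+\{\!\{\alpha,\beta\}\!\}\gamma$ and by $\{\!\{\alpha,\beta\}\!\}=-(-1)^{(|\alpha|-1)(|\beta|-1)}\sigma_{(12)}\{\!\{\beta,\alpha\}\!\}$, where $\sigma_{(12)}(x\otimes y)=(-1)^{|x||y|}y\otimes x$. Let $\{\alpha,\beta\}\in\mathbb{D}S$ be the image of $\{\!\{\alpha,\beta\}\!\}$ under multiplication, and let $[\mathbb{D}S,\mathbb{D}S]$ be the span of the graded commutators. For $i\ne j$, $1\le u\le n_j$ and $1\le v\le n_i$, let $y^{ij}_{uv}\in\mathbb{D}\mathrm{er}(S)$ be the double derivation of the arrow $j\to i$ of colour $(u,v)$, namely $$y^{ij}_{uv}(x)=e^j_{u1}\otimes e^i_{1v}x-x\,e^j_{u1}\otimes e^i_{1v}.$$ Let $p\neq q$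 and let $P=y^{pq}_{ab}\,y^{qp}_{cd}\in\mathbb{D}S$, with $1\le a,d\le n_q$ and $1\le b,c\le n_p$. Then: 1. if $S_p\ne K$ and $S_q\neq K$, then $\{P,P\}=0 \bmod [\mathbb{D}S,\mathbb{D}S]$ if and only if $(a-d)(b-c)\neq0$; 2. if $S_p\neq K$ and $S_q=K$, then $\{P,P\}=0 \bmod [\mathbb{D}S,\mathbb{D}S]$ if and only if $a-d\neq0$; 3. if $S_p=K$ and $S_q\neq K$, then $\{P,P\}=0 \bmod [\mathbb{D}S,\mathbb{D}S]$ if and only if $b-c\neq 0$; 4. if $S_p=K$ and $S_q=K$, then $\{P,P\}=0 \bmod [\mathbb{D}S,\mathbb{D}S]$. (In case 2 one has $a=d=1$ and in case 3 one has $b=c=1$, so in these two cases $\{P,P\}$ is never $0$ modulo commutators.) In each of these cases the induced double bracket on $S$, with $\delta=y^{pq}_{ab}$ and $\Delta=y^{qp}_{cd}$, $$\{\!\{x,y\}\!\}_P=\Delta(y)'\delta(x)''\otimes\delta(x)'\Delta(y)''-\delta(y)'\Delta(x)''\otimes\Delta(x)'\delta(y)'',$$ is not identically zero. -/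

import Mathlib

open scoped TensorProduct

namespace DoublePoisson

section General

variable (K : Type*) (A : Type*) [Field K] [Ring A] [Algebra K A]

/-- Double derivations `A → A ⊗ A`: linear maps satisfying the Leibniz rule for the outer
bimodule structure `a · (u ⊗ v) · b = a u ⊗ v b` on `A ⊗ A`. -/
def DoubleDer : Submodule K (A →ₗ[K] A ⊗[K] A) where
  carrier := {δ | ∀ x y : A, δ (x * y) = (x ⊗ₜ[K] 1) * δ y + δ x * (1 ⊗ₜ[K] y)}
  add_mem' {δ Δ} hδ hΔ x y := by
    simp only [Set.mem_ofPred_eq, LinearMap.add_apply] at *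
    rw [hδ, hΔ, mul_add, add_mul]; abel
  zero_mem' x y := by simp
  smul_mem' c δ hδ x y := by
    simp only [Set.mem_ofPred_eq, LinearMap.smul_apply] at *
    rw [hδ, smul_add, mul_smul_comm, smul_mul_assoc]

variable {K A}

theorem DoubleDer.leibniz (δ : DoubleDer K A) (x y : A) :
    δ.1 (x * y) = (x ⊗ₜ[K] 1) * δ.1 y + δ.1 x * (1 ⊗ₜ[K] y) := δ.2 x y

theorem DoubleDer.map_one (δ : DoubleDer K A) : δ.1 1 = 0 := by
  have h := DoubleDer.leibniz δ 1 1
  simpa [← Algebra.TensorProduct.one_def] using h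

variable (K A)

/-- The left inner action `(s · δ)(x) = δ(x)' ⊗ s δ(x)''`. -/
def innerL : A →ₗ[K] DoubleDer K A →ₗ[K] DoubleDer K A :=
  LinearMap.mk₂ K
    (fun s δ => ⟨LinearMap.mulLeft K ((1 : A) ⊗ₜ[K] s) ∘ₗ δ.1, fun x y => by
      simp only [LinearMap.comp_apply, LinearMap.mulLeft_apply, DoubleDer.leibniz δ, mul_add, ← mul_assoc,
        Algebra.TensorProduct.tmul_mul_tmul, one_mul, mul_one]⟩)
    (fun s t δ => by ext x; simp [TensorProduct.tmul_add, add_mul])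
    (fun c s δ => by ext x; simp [TensorProduct.tmul_smul])
    (fun s δ Δ => by ext x; simp [mul_add])
    (fun c s δ => by ext x; simp)

/-- The right inner action `(δ · t)(x) = δ(x)' t ⊗ δ(x)''`. -/
def innerR : A →ₗ[K] DoubleDer K A →ₗ[K] DoubleDer K A :=
  LinearMap.mk₂ K
    (fun t δ => ⟨LinearMap.mulRight K (t ⊗ₜ[K] (1 : A)) ∘ₗ δ.1, fun x y => by
      simp only [LinearMap.comp_apply, LinearMap.mulRight_apply, DoubleDer.leibniz δ, add_mul, mul_assoc,
        Algebra.TensorProduct.tmul_mul_tmul, one_mul, mul_one]⟩)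
    (fun s t δ => by ext x; simp [TensorProduct.add_tmul, mul_add])
    (fun c s δ => by ext x; simp [← TensorProduct.smul_tmul'])
    (fun s δ Δ => by ext x; simp [add_mul])
    (fun c s δ => by ext x; simp)

variable {K A}

@[simp] theorem innerL_apply (s : A) (δ : DoubleDer K A) (x : A) :
    (innerL K A s δ).1 x = ((1 : A) ⊗ₜ[K] s) * δ.1 x := rfl

@[simp] theorem innerR_apply (t : A) (δ : DoubleDer K A) (x : A) :
    (innerR K A t δ).1 x = δ.1 x * (t ⊗ₜ[K] (1 : A)) := rfl

/-- The inner double derivation `d_z(x) = z' ⊗ z'' x - x z' ⊗ z''` of `z ∈ A ⊗ A`. -/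
def innerDer (z : A ⊗[K] A) : DoubleDer K A :=
  ⟨LinearMap.mulLeft K z ∘ₗ TensorProduct.mk K A A 1
      - LinearMap.mulRight K z ∘ₗ (TensorProduct.mk K A A).flip 1, fun x y => by
    simp only [LinearMap.sub_apply, LinearMap.comp_apply, LinearMap.mulLeft_apply,
      LinearMap.mulRight_apply, TensorProduct.mk_apply, LinearMap.flip_apply, mul_sub, sub_mul,
      ← mul_assoc, Algebra.TensorProduct.tmul_mul_tmul, mul_one]
    rw [mul_assoc z, Algebra.TensorProduct.tmul_mul_tmul, one_mul]
    abel⟩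

theorem innerDer_apply (z : A ⊗[K] A) (x : A) :
    (innerDer z).1 x = z * (1 ⊗ₜ[K] x) - (x ⊗ₜ[K] 1) * z := rfl

variable (K A)

/-- The relations presenting the tensor algebra `T_A (Der(A, A ⊗ A))` of the `A`-bimodule of double
derivations as a quotient of the tensor algebra over `K` of `A × Der(A, A ⊗ A)`. -/
inductive Rel : TensorAlgebra K (A × DoubleDer K A) → TensorAlgebra K (A × DoubleDer K A) → Prop
  | one : Rel (TensorAlgebra.ι K (1, 0)) 1
  | mul (s t : A) : Rel (TensorAlgebra.ι K (s * t, 0))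
      (TensorAlgebra.ι K (s, 0) * TensorAlgebra.ι K (t, 0))
  | left (s : A) (δ : DoubleDer K A) : Rel (TensorAlgebra.ι K (0, innerL K A s δ))
      (TensorAlgebra.ι K (s, 0) * TensorAlgebra.ι K (0, δ))
  | right (δ : DoubleDer K A) (t : A) : Rel (TensorAlgebra.ι K (0, innerR K A t δ))
      (TensorAlgebra.ι K (0, δ) * TensorAlgebra.ι K (t, 0))

/-- The algebra `𝔻A = T_A (Der(A, A ⊗ A))`, the tensor algebra over `A` of the `A`-bimodule of
double derivations. -/
def DS : Type _ := RingQuot (Rel K A)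

instance : Ring (DS K A) := inferInstanceAs (Ring (RingQuot (Rel K A)))

instance : Algebra K (DS K A) := inferInstanceAs (Algebra K (RingQuot (Rel K A)))

namespace DS

/-- The quotient map onto `𝔻A`. -/
def quot : TensorAlgebra K (A × DoubleDer K A) →ₐ[K] DS K A := RingQuot.mkAlgHom K (Rel K A)

/-- The inclusion of `A` in `𝔻A` as the elements of degree `0`. -/
def incl : A →ₐ[K] DS K A :=
  AlgHom.ofLinearMap
    ((quot K A).toLinearMap ∘ₗ TensorAlgebra.ι K ∘ₗ LinearMap.inl K A (DoubleDer K A))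
    ((RingQuot.mkAlgHom_rel K (Rel.one (K := K) (A := A))).trans (map_one (quot K A)))
    (fun s t => (RingQuot.mkAlgHom_rel K (Rel.mul (K := K) s t)).trans (map_mul (quot K A) _ _))

/-- The inclusion of the double derivations in `𝔻A` as the elements of degree `1`. -/
def gen : DoubleDer K A →ₗ[K] DS K A :=
  (quot K A).toLinearMap ∘ₗ TensorAlgebra.ι K ∘ₗ LinearMap.inr K A (DoubleDer K A)

variable {K A}

theorem gen_innerL (s : A) (δ : DoubleDer K A) :
    gen K A (innerL K A s δ) = incl K A s * gen K A δ :=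
  (RingQuot.mkAlgHom_rel K (Rel.left (K := K) s δ)).trans (map_mul (quot K A) _ _)

theorem gen_innerR (δ : DoubleDer K A) (t : A) :
    gen K A (innerR K A t δ) = gen K A δ * incl K A t :=
  (RingQuot.mkAlgHom_rel K (Rel.right (K := K) δ t)).trans (map_mul (quot K A) _ _)

/-- The universal property of `𝔻A` as a tensor algebra over `A`. -/
def lift {R : Type*} [Ring R] [Algebra K R] (f : A →ₐ[K] R) (g : DoubleDer K A →ₗ[K] R)
    (hl : ∀ s δ, g (innerL K A s δ) = f s * g δ) (hr : ∀ δ t, g (innerR K A t δ) = g δ * f t) :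
    DS K A →ₐ[K] R :=
  RingQuot.liftAlgHom K ⟨TensorAlgebra.lift K (f.toLinearMap.coprod g), fun {x y} h => by
    cases h <;> simp [hl, hr]⟩

section lift
variable {R : Type*} [Ring R] [Algebra K R] (f : A →ₐ[K] R) (g : DoubleDer K A →ₗ[K] R)
    (hl : ∀ s δ, g (innerL K A s δ) = f s * g δ) (hr : ∀ δ t, g (innerR K A t δ) = g δ * f t)

@[simp] theorem lift_incl (s : A) : lift f g hl hr (incl K A s) = f s := by
  have h : lift f g hl hr (incl K A s)
      = TensorAlgebra.lift K (f.toLinearMap.coprod g) (TensorAlgebra.ι K (s, 0)) :=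
    RingQuot.liftAlgHom_mkAlgHom_apply K _ _ _
  simp [h]

@[simp] theorem lift_gen (δ : DoubleDer K A) : lift f g hl hr (gen K A δ) = g δ := by
  have h : lift f g hl hr (gen K A δ)
      = TensorAlgebra.lift K (f.toLinearMap.coprod g) (TensorAlgebra.ι K (0, δ)) :=
    RingQuot.liftAlgHom_mkAlgHom_apply K _ _ _
  simp [h]
end lift

theorem induction {P : DS K A → Prop} (hi : ∀ s, P (incl K A s)) (hg : ∀ δ, P (gen K A δ))
    (hm : ∀ x y, P x → P y → P (x * y)) (ha : ∀ x y, P x → P y → P (x + y)) (x : DS K A) : P x := by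
  obtain ⟨x, rfl⟩ := RingQuot.mkAlgHom_surjective K (Rel K A) x
  change P (quot K A x)
  induction x using TensorAlgebra.induction with
  | algebraMap r =>
    have := hi (algebraMap K A r)
    rw [AlgHom.commutes] at this
    rw [AlgHom.commutes]
    exact this
  | ι m =>
    have h : quot K A (TensorAlgebra.ι K m) = incl K A m.1 + gen K A m.2 := by
      change quot K A (TensorAlgebra.ι K m) = quot K A (TensorAlgebra.ι K (m.1, 0))
        + quot K A (TensorAlgebra.ι K (0, m.2))
      rw [← map_add, ← map_add]; simp
    rw [h]; exact ha _ _ (hi _) (hg _)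
  | mul a b h1 h2 => rw [map_mul]; exact hm _ _ h1 h2
  | add a b h1 h2 => rw [map_add]; exact ha _ _ h1 h2

theorem algHom_ext {R : Type*} [Ring R] [Algebra K R] {φ ψ : DS K A →ₐ[K] R}
    (hi : ∀ s, φ (incl K A s) = ψ (incl K A s)) (hg : ∀ δ, φ (gen K A δ) = ψ (gen K A δ)) :
    φ = ψ := by
  ext x
  induction x using induction with
  | hi s => exact hi s
  | hg δ => exact hg δ
  | hm x y h1 h2 => rw [map_mul, map_mul, h1, h2]
  | ha x y h1 h2 => rw [map_add, map_add, h1, h2]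

variable (K A)

/-- The parity automorphism: it multiplies elements of degree `n` by `(-1) ^ n`. -/
def parity : DS K A →ₐ[K] DS K A :=
  lift (incl K A) (-gen K A) (fun s δ => by simp [gen_innerL]) (fun δ t => by simp [gen_innerR])

variable {K A}

@[simp] theorem parity_incl (s : A) : parity K A (incl K A s) = incl K A s := lift_incl _ _ _ _ s

@[simp] theorem parity_gen (δ : DoubleDer K A) : parity K A (gen K A δ) = -gen K A δ :=
  lift_gen _ _ _ _ δ

@[simp] theorem parity_parity (x : DS K A) : parity K A (parity K A x) = x := by
  have : (parity K A).comp (parity K A) = AlgHom.id K _ := algHom_ext (by simp) (by simp)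
  exact DFunLike.congr_fun this x

end DS

section Brackets

variable {K A}

/-- `(1 ⊗ δ) Δ - (Δ ⊗ 1) δ`. -/
def rTilde (δ Δ : DoubleDer K A) : A →ₗ[K] A ⊗[K] (A ⊗[K] A) :=
  LinearMap.lTensor A δ.1 ∘ₗ Δ.1
    - (TensorProduct.assoc K A A A).toLinearMap ∘ₗ LinearMap.rTensor A Δ.1 ∘ₗ δ.1

/-- `(δ ⊗ 1) Δ - (1 ⊗ Δ) δ`. -/
def lTilde (δ Δ : DoubleDer K A) : A →ₗ[K] A ⊗[K] (A ⊗[K] A) :=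
  (TensorProduct.assoc K A A A).toLinearMap ∘ₗ LinearMap.rTensor A δ.1 ∘ₗ Δ.1
    - LinearMap.lTensor A Δ.1 ∘ₗ δ.1

/-- `a ⊗ θ`, viewed as the map `x ↦ a ⊗ θ(x)`. -/
def evR : A ⊗[K] DoubleDer K A →ₗ[K] A →ₗ[K] A ⊗[K] (A ⊗[K] A) :=
  TensorProduct.lift (LinearMap.mk₂ K (fun a θ => TensorProduct.mk K A (A ⊗[K] A) a ∘ₗ θ.1)
    (fun a b θ => by ext x; simp)
    (fun c a θ => by ext x; simp [TensorProduct.smul_tmul'])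
    (fun a θ η => by ext x; simp [TensorProduct.tmul_add])
    (fun c a θ => by ext x; simp))

/-- `θ ⊗ a`, viewed as the map `x ↦ θ(x) ⊗ a`. -/
def evL : DoubleDer K A ⊗[K] A →ₗ[K] A →ₗ[K] A ⊗[K] (A ⊗[K] A) :=
  TensorProduct.lift (LinearMap.mk₂ K
    (fun θ a => (TensorProduct.assoc K A A A).toLinearMap ∘ₗ
      (TensorProduct.mk K (A ⊗[K] A) A).flip a ∘ₗ θ.1)
    (fun θ η a => by ext x; simp)
    (fun c θ a => by ext x; simp)
    (fun θ a b => by ext x; simp)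
    (fun c θ a => by ext x; simp))

@[simp] theorem evR_tmul (a : A) (θ : DoubleDer K A) (x : A) :
    evR (a ⊗ₜ[K] θ) x = a ⊗ₜ[K] θ.1 x := rfl

@[simp] theorem evL_tmul (a : A) (θ : DoubleDer K A) (x : A) :
    evL (θ ⊗ₜ[K] a) x = TensorProduct.assoc K A A A (θ.1 x ⊗ₜ[K] a) := rfl

theorem assoc_mul (x y : (A ⊗[K] A) ⊗[K] A) : TensorProduct.assoc K A A A (x * y)
    = TensorProduct.assoc K A A A x * TensorProduct.assoc K A A A y :=
  map_mul (Algebra.TensorProduct.assoc K K K A A A) x y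

theorem leftComm_mul (x y : A ⊗[K] (A ⊗[K] A)) : TensorProduct.leftComm K A A A (x * y)
    = TensorProduct.leftComm K A A A x * TensorProduct.leftComm K A A A y :=
  map_mul (Algebra.TensorProduct.leftComm K A A A) x y

theorem rTilde_leibniz (δ Δ : DoubleDer K A) (x y : A) :
    rTilde δ Δ (x * y) = (x ⊗ₜ[K] ((1 : A) ⊗ₜ[K] (1 : A))) * rTilde δ Δ y
      + rTilde δ Δ x * ((1 : A) ⊗ₜ[K] ((1 : A) ⊗ₜ[K] y)) := by
  have h1 : ∀ z : A ⊗[K] A, LinearMap.lTensor A δ.1 ((x ⊗ₜ[K] 1) * z)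
      = (x ⊗ₜ[K] ((1 : A) ⊗ₜ[K] (1 : A))) * LinearMap.lTensor A δ.1 z := by
    intro z
    induction z using TensorProduct.induction_on with
    | zero => simp
    | tmul u v => simp [← Algebra.TensorProduct.one_def]
    | add u v hu hv => simp only [mul_add, map_add, hu, hv]
  have h2 : ∀ z : A ⊗[K] A, LinearMap.lTensor A δ.1 (z * (1 ⊗ₜ[K] y))
      = LinearMap.lTensor A δ.1 z * ((1 : A) ⊗ₜ[K] ((1 : A) ⊗ₜ[K] y))
        + TensorProduct.assoc K A A A (z ⊗ₜ[K] 1) * ((1 : A) ⊗ₜ[K] δ.1 y) := by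
    intro z
    induction z using TensorProduct.induction_on with
    | zero => simp
    | tmul u v => simp [DoubleDer.leibniz δ v y, TensorProduct.tmul_add, add_comm]
    | add u v hu hv => simp only [add_mul, map_add, hu, hv, TensorProduct.add_tmul]; abel
  have h3 : ∀ z : A ⊗[K] A,
      TensorProduct.assoc K A A A (LinearMap.rTensor A Δ.1 (z * (1 ⊗ₜ[K] y)))
      = TensorProduct.assoc K A A A (LinearMap.rTensor A Δ.1 z)
        * ((1 : A) ⊗ₜ[K] ((1 : A) ⊗ₜ[K] y)) := by
    intro z
    induction z using TensorProduct.induction_on with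
    | zero => simp
    | tmul u v =>
      have : ((1 : A) ⊗ₜ[K] ((1 : A) ⊗ₜ[K] y))
        = TensorProduct.assoc K A A A (((1 : A) ⊗ₜ[K] (1 : A)) ⊗ₜ[K] y) := rfl
      rw [this, ← assoc_mul]
      simp [← Algebra.TensorProduct.one_def]
    | add u v hu hv => simp only [add_mul, map_add, hu, hv]
  have h4 : ∀ w : A ⊗[K] A,
      TensorProduct.assoc K A A A (LinearMap.rTensor A Δ.1 ((x ⊗ₜ[K] 1) * w))
      = (x ⊗ₜ[K] ((1 : A) ⊗ₜ[K] (1 : A))) * TensorProduct.assoc K A A A (LinearMap.rTensor A Δ.1 w)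
        + TensorProduct.assoc K A A A (Δ.1 x ⊗ₜ[K] 1) * ((1 : A) ⊗ₜ[K] w) := by
    intro z
    induction z using TensorProduct.induction_on with
    | zero => simp
    | tmul u v =>
      have h : (x ⊗ₜ[K] ((1 : A) ⊗ₜ[K] (1 : A)))
        = TensorProduct.assoc K A A A ((x ⊗ₜ[K] (1 : A)) ⊗ₜ[K] (1 : A)) := rfl
      have h' : ((1 : A) ⊗ₜ[K] (u ⊗ₜ[K] v))
        = TensorProduct.assoc K A A A (((1 : A) ⊗ₜ[K] u) ⊗ₜ[K] v) := rfl
      rw [h, h', ← assoc_mul, ← assoc_mul, ← map_add]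
      simp [DoubleDer.leibniz Δ x u, TensorProduct.add_tmul]
    | add u v hu hv => simp only [mul_add, map_add, hu, hv, TensorProduct.tmul_add]; abel
  simp only [rTilde, LinearMap.sub_apply, LinearMap.comp_apply, LinearEquiv.coe_coe,
    DoubleDer.leibniz, map_add, h1, h2, h3, h4, mul_sub, sub_mul]
  abel

theorem lTilde_eq (δ Δ : DoubleDer K A) : lTilde δ Δ = -rTilde Δ δ := by
  simp only [lTilde, rTilde]; abel

/-- The map `{{δ, Δ}}_r : A → A ⊗ (A ⊗ A)`, that is `τ₍₁₂₎ ((1 ⊗ δ) Δ - (Δ ⊗ 1) δ)`. -/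
def rMap (δ Δ : DoubleDer K A) : A →ₗ[K] A ⊗[K] (A ⊗[K] A) :=
  (TensorProduct.leftComm K A A A).toLinearMap ∘ₗ rTilde δ Δ

/-- The map `{{δ, Δ}}_l : A → A ⊗ (A ⊗ A)`, that is `τ₍₂₃₎ ((δ ⊗ 1) Δ - (1 ⊗ Δ) δ)`. -/
def lMap (δ Δ : DoubleDer K A) : A →ₗ[K] A ⊗[K] (A ⊗[K] A) :=
  LinearMap.lTensor A (TensorProduct.comm K A A).toLinearMap ∘ₗ lTilde δ Δ

theorem rMap_leibniz (δ Δ : DoubleDer K A) (x y : A) :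
    rMap δ Δ (x * y) = ((1 : A) ⊗ₜ[K] (x ⊗ₜ[K] (1 : A))) * rMap δ Δ y
      + rMap δ Δ x * ((1 : A) ⊗ₜ[K] ((1 : A) ⊗ₜ[K] y)) := by
  simp [rMap, rTilde_leibniz, leftComm_mul]

/-- The contraction of the first tensor factor with a linear form. -/
def contr {M : Type*} [AddCommMonoid M] [Module K M] (f : A →ₗ[K] K) : A ⊗[K] M →ₗ[K] M :=
  (TensorProduct.lid K M).toLinearMap ∘ₗ LinearMap.rTensor M f

@[simp] theorem contr_tmul {M : Type*} [AddCommMonoid M] [Module K M] (f : A →ₗ[K] K) (a : A)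
    (m : M) : contr f (a ⊗ₜ[K] m) = f a • m := rfl

theorem contr_mul_left (f : A →ₗ[K] K) (w : A ⊗[K] A) (z : A ⊗[K] (A ⊗[K] A)) :
    contr f (((1 : A) ⊗ₜ[K] w) * z) = w * contr f z := by
  induction z using TensorProduct.induction_on with
  | zero => simp
  | tmul u v => simp
  | add u v hu hv => simp only [mul_add, map_add, hu, hv]

theorem contr_mul_right (f : A →ₗ[K] K) (w : A ⊗[K] A) (z : A ⊗[K] (A ⊗[K] A)) :
    contr f (z * ((1 : A) ⊗ₜ[K] w)) = contr f z * w := by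
  induction z using TensorProduct.induction_on with
  | zero => simp
  | tmul u v => simp
  | add u v hu hv => simp only [add_mul, map_add, hu, hv]

/-- A contraction of `{{δ, Δ}}_r`, as a double derivation. -/
def rContr (δ Δ : DoubleDer K A) (f : A →ₗ[K] K) : DoubleDer K A :=
  ⟨contr f ∘ₗ rMap δ Δ, fun x y => by
    simp [rMap_leibniz, contr_mul_left, contr_mul_right]⟩

theorem sum_contr [Module.Finite K A] {M : Type*} [AddCommMonoid M] [Module K M] (z : A ⊗[K] M) :
    ∑ i, Module.finBasis K A i ⊗ₜ[K] contr ((Module.finBasis K A).coord i) z = z := by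
  induction z using TensorProduct.induction_on with
  | zero => simp
  | tmul u v =>
    simp only [contr_tmul, Module.Basis.coord_apply, ← TensorProduct.smul_tmul,
      ← TensorProduct.sum_tmul, Module.Basis.sum_repr]
  | add u v hu hv => simp only [map_add, TensorProduct.tmul_add, Finset.sum_add_distrib, hu, hv]

theorem contr_evR (f : A →ₗ[K] K) (z : A ⊗[K] DoubleDer K A) (x : A) :
    contr f (evR z x) = (contr f z).1 x := by
  induction z using TensorProduct.induction_on with
  | zero => simp
  | tmul u v => simp
  | add u v hu hv => simp [hu, hv]

theorem evL_comm (z : A ⊗[K] DoubleDer K A) (x : A) :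
    evL (TensorProduct.comm K A (DoubleDer K A) z) x
      = LinearMap.lTensor A (TensorProduct.comm K A A).toLinearMap
        (TensorProduct.leftComm K A A A (evR z x)) := by
  induction z using TensorProduct.induction_on with
  | zero => simp
  | tmul u v =>
    simp only [TensorProduct.comm_tmul, evL_tmul, evR_tmul]
    generalize v.1 x = w
    induction w using TensorProduct.induction_on with
    | zero => simp
    | tmul u v => simp
    | add u v hu hv => simp only [map_add, TensorProduct.add_tmul, TensorProduct.tmul_add, hu, hv]
  | add u v hu hv => simp only [map_add, LinearMap.add_apply, hu, hv]

theorem leftComm_leftComm (z : A ⊗[K] (A ⊗[K] A)) :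
    TensorProduct.leftComm K A A A (TensorProduct.leftComm K A A A z) = z :=
  (TensorProduct.leftComm K A A A).symm_apply_apply z

variable [Module.Finite K A]

theorem evR_injective : Function.Injective (evR (K := K) (A := A)) := by
  intro z w h
  rw [← sum_contr z, ← sum_contr w]
  refine Finset.sum_congr rfl fun i _ => ?_
  congr 1
  ext x
  rw [← contr_evR, ← contr_evR, h]

/-- The component `{{δ, Δ}}_r` of the double Schouten bracket, as an element of `A ⊗ Der(A, A ⊗ A)`:
the only element that acts as the map `rMap δ Δ`. -/
noncomputable def schoutenR (δ Δ : DoubleDer K A) : A ⊗[K] DoubleDer K A :=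
  ∑ i, Module.finBasis K A i ⊗ₜ[K] rContr δ Δ ((Module.finBasis K A).coord i)

theorem evR_schoutenR (δ Δ : DoubleDer K A) : evR (schoutenR δ Δ) = rMap δ Δ := by
  ext x
  rw [← sum_contr (rMap δ Δ x)]
  simp [schoutenR, rContr]

/-- The component `{{δ, Δ}}_l` of the double Schouten bracket, as an element of `Der(A, A ⊗ A) ⊗ A`:
the only element that acts as the map `lMap δ Δ`. -/
noncomputable def schoutenL (δ Δ : DoubleDer K A) : DoubleDer K A ⊗[K] A :=
  (-1 : K) • TensorProduct.comm K A (DoubleDer K A) (schoutenR Δ δ)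

theorem evL_schoutenL (δ Δ : DoubleDer K A) : evL (schoutenL δ Δ) = lMap δ Δ := by
  ext x
  simp [schoutenL, evL_comm, evR_schoutenR, lMap, lTilde_eq, rMap, leftComm_leftComm]

theorem evL_injective : Function.Injective (evL (K := K) (A := A)) := by
  intro z w h
  obtain ⟨z, rfl⟩ := (TensorProduct.comm K A (DoubleDer K A)).surjective z
  obtain ⟨w, rfl⟩ := (TensorProduct.comm K A (DoubleDer K A)).surjective w
  congr 1
  apply evR_injective
  ext x
  have h1 := DFunLike.congr_fun h x
  rw [evL_comm, evL_comm] at h1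
  exact (TensorProduct.leftComm K A A A).injective
    ((LinearEquiv.lTensor A (TensorProduct.comm K A A)).injective h1)

end Brackets

section GeneratorBracket

variable {K A}
variable [Module.Finite K A]

theorem schoutenR_add_right (δ Δ Γ : DoubleDer K A) :
    schoutenR δ (Δ + Γ) = schoutenR δ Δ + schoutenR δ Γ := by
  apply evR_injective
  ext x
  simp only [map_add, evR_schoutenR, rMap, rTilde, LinearMap.add_apply, LinearMap.comp_apply,
    LinearMap.sub_apply, LinearEquiv.coe_coe, Submodule.coe_add, LinearMap.rTensor_add, map_sub]
  abel

theorem schoutenR_smul_right (c : K) (δ Δ : DoubleDer K A) :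
    schoutenR δ (c • Δ) = c • schoutenR δ Δ := by
  apply evR_injective
  ext x
  simp only [map_smul, evR_schoutenR, rMap, rTilde, LinearMap.smul_apply, LinearMap.comp_apply,
    LinearMap.sub_apply, LinearEquiv.coe_coe, Submodule.coe_smul, LinearMap.rTensor_smul, map_sub,
    smul_sub]

theorem schoutenR_add_left (δ Δ Γ : DoubleDer K A) :
    schoutenR (δ + Δ) Γ = schoutenR δ Γ + schoutenR Δ Γ := by
  apply evR_injective
  ext x
  simp only [map_add, evR_schoutenR, rMap, rTilde, LinearMap.add_apply, LinearMap.comp_apply,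
    LinearMap.sub_apply, LinearEquiv.coe_coe, Submodule.coe_add, LinearMap.lTensor_add, map_sub]
  abel

theorem schoutenR_smul_left (c : K) (δ Δ : DoubleDer K A) :
    schoutenR (c • δ) Δ = c • schoutenR δ Δ := by
  apply evR_injective
  ext x
  simp only [map_smul, evR_schoutenR, rMap, rTilde, LinearMap.smul_apply, LinearMap.comp_apply,
    LinearMap.sub_apply, LinearEquiv.coe_coe, Submodule.coe_smul, LinearMap.lTensor_smul, map_sub,
    smul_sub]

theorem schoutenR_innerL (δ Δ : DoubleDer K A) (s : A) :
    schoutenR δ (innerL K A s Δ) = LinearMap.rTensor _ (LinearMap.mulLeft K s) (schoutenR δ Δ)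
      + LinearMap.lTensor A ((innerL K A).flip Δ) (δ.1 s) := by
  apply evR_injective
  ext x
  have e1 : ∀ z : A ⊗[K] DoubleDer K A, evR (LinearMap.rTensor _ (LinearMap.mulLeft K s) z) x
      = (s ⊗ₜ[K] (1 : A ⊗[K] A)) * evR z x := by
    intro z
    induction z using TensorProduct.induction_on with
    | zero => simp
    | tmul u v => simp
    | add u v hu hv => simp only [mul_add, map_add, hu, hv, LinearMap.add_apply]
  have e2 : ∀ w : A ⊗[K] A, evR (LinearMap.lTensor A ((innerL K A).flip Δ) w) x
      = TensorProduct.leftComm K A A A (((1 : A) ⊗ₜ[K] w) *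
        LinearMap.lTensor A (TensorProduct.mk K A A 1) (Δ.1 x)) := by
    intro w
    induction w using TensorProduct.induction_on with
    | zero => simp
    | tmul u v =>
      simp only [LinearMap.lTensor_tmul, LinearMap.flip_apply, evR_tmul, innerL_apply]
      generalize Δ.1 x = z
      induction z using TensorProduct.induction_on with
      | zero => simp
      | tmul a b => simp
      | add a b ha hb => simp only [mul_add, map_add, TensorProduct.tmul_add, ha, hb]
    | add u v hu hv =>
      simp only [add_mul, map_add, hu, hv, LinearMap.add_apply, TensorProduct.tmul_add]
  have e3 : ∀ z : A ⊗[K] A, LinearMap.lTensor A δ.1 (((1 : A) ⊗ₜ[K] s) * z)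
      = ((1 : A) ⊗ₜ[K] (s ⊗ₜ[K] (1 : A))) * LinearMap.lTensor A δ.1 z
        + ((1 : A) ⊗ₜ[K] δ.1 s) * LinearMap.lTensor A (TensorProduct.mk K A A 1) z := by
    intro z
    induction z using TensorProduct.induction_on with
    | zero => simp
    | tmul a b => simp [DoubleDer.leibniz δ s b, TensorProduct.tmul_add]
    | add a b ha hb => simp only [mul_add, map_add, ha, hb]; abel
  have e4 : ∀ z : A ⊗[K] A,
      TensorProduct.assoc K A A A (LinearMap.rTensor A (innerL K A s Δ).1 z)
      = ((1 : A) ⊗ₜ[K] (s ⊗ₜ[K] (1 : A)))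
        * TensorProduct.assoc K A A A (LinearMap.rTensor A Δ.1 z) := by
    intro z
    induction z using TensorProduct.induction_on with
    | zero => simp
    | tmul a b =>
      have h : ((1 : A) ⊗ₜ[K] (s ⊗ₜ[K] (1 : A)))
        = TensorProduct.assoc K A A A (((1 : A) ⊗ₜ[K] s) ⊗ₜ[K] (1 : A)) := rfl
      rw [h, ← assoc_mul]; simp
    | add a b ha hb => simp only [mul_add, map_add, ha, hb]
  have e5 : TensorProduct.leftComm K A A A ((1 : A) ⊗ₜ[K] (s ⊗ₜ[K] (1 : A)))
    = (s ⊗ₜ[K] (1 : A ⊗[K] A)) := rfl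
  simp only [map_add, LinearMap.add_apply, e1, e2, evR_schoutenR, rMap, rTilde,
    LinearMap.comp_apply, LinearMap.sub_apply, LinearEquiv.coe_coe, innerL_apply, e3, e4, map_sub,
    leftComm_mul, e5, mul_sub]
  abel

theorem schoutenR_innerR (δ Δ : DoubleDer K A) (t : A) :
    schoutenR δ (innerR K A t Δ) = LinearMap.lTensor A (innerR K A t) (schoutenR δ Δ) := by
  apply evR_injective
  ext x
  have e1 : ∀ z : A ⊗[K] DoubleDer K A, evR (LinearMap.lTensor A (innerR K A t) z) x
      = evR z x * ((1 : A) ⊗ₜ[K] (t ⊗ₜ[K] (1 : A))) := by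
    intro z
    induction z using TensorProduct.induction_on with
    | zero => simp
    | tmul u v => simp
    | add u v hu hv => simp only [add_mul, map_add, hu, hv, LinearMap.add_apply]
  have e3 : ∀ z : A ⊗[K] A, LinearMap.lTensor A δ.1 (z * (t ⊗ₜ[K] (1 : A)))
      = LinearMap.lTensor A δ.1 z * (t ⊗ₜ[K] (1 : A ⊗[K] A)) := by
    intro z
    induction z using TensorProduct.induction_on with
    | zero => simp
    | tmul a b => simp
    | add a b ha hb => simp only [add_mul, map_add, ha, hb]
  have e4 : ∀ z : A ⊗[K] A,
      TensorProduct.assoc K A A A (LinearMap.rTensor A (innerR K A t Δ).1 z)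
      = TensorProduct.assoc K A A A (LinearMap.rTensor A Δ.1 z) * (t ⊗ₜ[K] (1 : A ⊗[K] A)) := by
    intro z
    induction z using TensorProduct.induction_on with
    | zero => simp
    | tmul a b =>
      have h : (t ⊗ₜ[K] (1 : A ⊗[K] A))
        = TensorProduct.assoc K A A A ((t ⊗ₜ[K] (1 : A)) ⊗ₜ[K] (1 : A)) := rfl
      rw [h, ← assoc_mul]; simp
    | add a b ha hb => simp only [add_mul, map_add, ha, hb]
  have e5 : TensorProduct.leftComm K A A A (t ⊗ₜ[K] (1 : A ⊗[K] A))
    = ((1 : A) ⊗ₜ[K] (t ⊗ₜ[K] (1 : A))) := rfl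
  simp only [e1, evR_schoutenR, rMap, rTilde,
    LinearMap.comp_apply, LinearMap.sub_apply, LinearEquiv.coe_coe, innerR_apply, e3, e4, map_sub,
    leftComm_mul, e5, sub_mul]

theorem schoutenR_innerL_left (δ Δ : DoubleDer K A) (s : A) :
    schoutenR (innerL K A s δ) Δ = LinearMap.lTensor A (innerL K A s) (schoutenR δ Δ) := by
  apply evR_injective
  ext x
  have e1 : ∀ z : A ⊗[K] DoubleDer K A, evR (LinearMap.lTensor A (innerL K A s) z) x
      = ((1 : A) ⊗ₜ[K] ((1 : A) ⊗ₜ[K] s)) * evR z x := by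
    intro z
    induction z using TensorProduct.induction_on with
    | zero => simp
    | tmul u v => simp
    | add u v hu hv => simp only [mul_add, map_add, hu, hv, LinearMap.add_apply]
  have e3 : ∀ z : A ⊗[K] A, LinearMap.lTensor A (innerL K A s δ).1 z
      = ((1 : A) ⊗ₜ[K] ((1 : A) ⊗ₜ[K] s)) * LinearMap.lTensor A δ.1 z := by
    intro z
    induction z using TensorProduct.induction_on with
    | zero => simp
    | tmul a b => simp
    | add a b ha hb => simp only [mul_add, map_add, ha, hb]
  have e4 : ∀ z : A ⊗[K] A,
      TensorProduct.assoc K A A A (LinearMap.rTensor A Δ.1 (((1 : A) ⊗ₜ[K] s) * z))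
      = ((1 : A) ⊗ₜ[K] ((1 : A) ⊗ₜ[K] s))
        * TensorProduct.assoc K A A A (LinearMap.rTensor A Δ.1 z) := by
    intro z
    induction z using TensorProduct.induction_on with
    | zero => simp
    | tmul a b =>
      have h : ((1 : A) ⊗ₜ[K] ((1 : A) ⊗ₜ[K] s))
        = TensorProduct.assoc K A A A ((1 : A ⊗[K] A) ⊗ₜ[K] s) := rfl
      rw [h, ← assoc_mul]; simp
    | add a b ha hb => simp only [mul_add, map_add, ha, hb]
  have e5 : TensorProduct.leftComm K A A A ((1 : A) ⊗ₜ[K] ((1 : A) ⊗ₜ[K] s))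
    = ((1 : A) ⊗ₜ[K] ((1 : A) ⊗ₜ[K] s)) := rfl
  simp only [e1, evR_schoutenR, rMap, rTilde,
    LinearMap.comp_apply, LinearMap.sub_apply, LinearEquiv.coe_coe, innerL_apply, e3, e4, map_sub,
    leftComm_mul, e5, mul_sub]

theorem schoutenR_innerR_left (δ Δ : DoubleDer K A) (t : A) :
    schoutenR (innerR K A t δ) Δ
        + LinearMap.lTensor A ((innerR K A).flip δ) (TensorProduct.comm K A A (Δ.1 t))
      = LinearMap.rTensor _ (LinearMap.mulRight K t) (schoutenR δ Δ) := by
  apply evR_injective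
  ext x
  have e1 : ∀ z : A ⊗[K] DoubleDer K A, evR (LinearMap.rTensor _ (LinearMap.mulRight K t) z) x
      = evR z x * (t ⊗ₜ[K] (1 : A ⊗[K] A)) := by
    intro z
    induction z using TensorProduct.induction_on with
    | zero => simp
    | tmul u v => simp
    | add u v hu hv => simp only [add_mul, map_add, hu, hv, LinearMap.add_apply]
  have e2 : ∀ w : A ⊗[K] A, evR (LinearMap.lTensor A ((innerR K A).flip δ)
        (TensorProduct.comm K A A w)) x
      = TensorProduct.leftComm K A A A (LinearMap.lTensor A (TensorProduct.mk K A A 1) (δ.1 x)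
        * TensorProduct.assoc K A A A (w ⊗ₜ[K] 1)) := by
    intro w
    induction w using TensorProduct.induction_on with
    | zero => simp
    | tmul u v =>
      simp only [LinearMap.lTensor_tmul, LinearMap.flip_apply, evR_tmul, innerR_apply,
        TensorProduct.comm_tmul]
      generalize δ.1 x = z
      induction z using TensorProduct.induction_on with
      | zero => simp
      | tmul a b => simp
      | add a b ha hb => simp only [add_mul, map_add, TensorProduct.tmul_add, ha, hb]
    | add u v hu hv =>
      simp only [mul_add, map_add, hu, hv, LinearMap.add_apply, TensorProduct.add_tmul]
  have e3 : ∀ z : A ⊗[K] A, LinearMap.lTensor A (innerR K A t δ).1 z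
      = LinearMap.lTensor A δ.1 z * ((1 : A) ⊗ₜ[K] (t ⊗ₜ[K] (1 : A))) := by
    intro z
    induction z using TensorProduct.induction_on with
    | zero => simp
    | tmul a b => simp
    | add a b ha hb => simp only [add_mul, map_add, ha, hb]
  have e4 : ∀ z : A ⊗[K] A,
      TensorProduct.assoc K A A A (LinearMap.rTensor A Δ.1 (z * (t ⊗ₜ[K] (1 : A))))
      = TensorProduct.assoc K A A A (LinearMap.rTensor A Δ.1 z)
          * ((1 : A) ⊗ₜ[K] (t ⊗ₜ[K] (1 : A)))
        + LinearMap.lTensor A (TensorProduct.mk K A A 1) z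
          * TensorProduct.assoc K A A A (Δ.1 t ⊗ₜ[K] 1) := by
    intro z
    induction z using TensorProduct.induction_on with
    | zero => simp
    | tmul a b =>
      have h : ((1 : A) ⊗ₜ[K] (t ⊗ₜ[K] (1 : A)))
        = TensorProduct.assoc K A A A (((1 : A) ⊗ₜ[K] t) ⊗ₜ[K] (1 : A)) := rfl
      have h' : LinearMap.lTensor A (TensorProduct.mk K A A 1) (a ⊗ₜ[K] b)
        = TensorProduct.assoc K A A A ((a ⊗ₜ[K] (1 : A)) ⊗ₜ[K] b) := rfl
      rw [h, h', ← assoc_mul, ← assoc_mul, ← map_add]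
      simp [DoubleDer.leibniz Δ a t, TensorProduct.add_tmul, add_comm]
    | add a b ha hb => simp only [add_mul, map_add, ha, hb]; abel
  have e5 : TensorProduct.leftComm K A A A ((1 : A) ⊗ₜ[K] (t ⊗ₜ[K] (1 : A)))
    = (t ⊗ₜ[K] (1 : A ⊗[K] A)) := rfl
  simp only [map_add, LinearMap.add_apply, e1, e2, evR_schoutenR, rMap, rTilde,
    LinearMap.comp_apply, LinearMap.sub_apply, LinearEquiv.coe_coe, innerR_apply, e3, e4, map_sub,
    leftComm_mul, e5, sub_mul]
  abel

end GeneratorBracket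

section OuterDerivations

variable {K A}

/-- The map `A ⊗ A → 𝔻A ⊗ 𝔻A`. -/
def inclTwo : A ⊗[K] A →ₐ[K] DS K A ⊗[K] DS K A :=
  Algebra.TensorProduct.map (DS.incl K A) (DS.incl K A)

@[simp] theorem inclTwo_tmul (a b : A) :
    inclTwo (K := K) (a ⊗ₜ[K] b) = DS.incl K A a ⊗ₜ[K] DS.incl K A b := rfl

/-- Linear maps `F : 𝔻A → 𝔻A ⊗ 𝔻A` such that `F(x y) = σ(x) F(y) + F(x) y`, for the outer bimodule
structure. -/
def IsOuterDer (σ : DS K A →ₐ[K] DS K A) (F : DS K A →ₗ[K] DS K A ⊗[K] DS K A) : Prop :=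
  ∀ x y, F (x * y) = (σ x ⊗ₜ[K] 1) * F y + F x * (1 ⊗ₜ[K] y)

namespace IsOuterDer

variable {σ : DS K A →ₐ[K] DS K A} {F G : DS K A →ₗ[K] DS K A ⊗[K] DS K A}

theorem add (hF : IsOuterDer σ F) (hG : IsOuterDer σ G) : IsOuterDer σ (F + G) := fun x y => by
  simp only [LinearMap.add_apply, hF x y, hG x y, mul_add, add_mul]; abel

theorem smul (c : K) (hF : IsOuterDer σ F) : IsOuterDer σ (c • F) := fun x y => by
  simp only [LinearMap.smul_apply, hF x y, smul_add, mul_smul_comm, smul_mul_assoc]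

theorem eq (hF : IsOuterDer σ F) (hG : IsOuterDer σ G)
    (hi : ∀ s, F (DS.incl K A s) = G (DS.incl K A s))
    (hg : ∀ δ, F (DS.gen K A δ) = G (DS.gen K A δ)) : F = G := by
  ext x
  induction x using DS.induction with
  | hi s => exact hi s
  | hg δ => exact hg δ
  | hm x y h1 h2 => rw [hF, hG, h1, h2]
  | ha x y h1 h2 => rw [map_add, map_add, h1, h2]

end IsOuterDer

section mkOuter

variable (σ : DS K A →ₐ[K] DS K A) (f : A →ₗ[K] DS K A ⊗[K] DS K A)
  (g : DoubleDer K A →ₗ[K] DS K A ⊗[K] DS K A)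

/-- The upper triangular matrix with diagonal `σ(x) ⊗ 1, 1 ⊗ x` and off-diagonal entry `w`. -/
def tri (x : DS K A) (w : DS K A ⊗[K] DS K A) : Matrix (Fin 2) (Fin 2) (DS K A ⊗[K] DS K A) :=
  !![σ x ⊗ₜ[K] 1, w; 0, 1 ⊗ₜ[K] x]

theorem tri_mul (x y : DS K A) (w z : DS K A ⊗[K] DS K A) :
    tri σ x w * tri σ y z = tri σ (x * y) ((σ x ⊗ₜ[K] 1) * z + w * (1 ⊗ₜ[K] y)) := by
  simp [tri]

/-- The existence of outer derivations with prescribed values on generators. -/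
theorem exists_outerDer
    (hf : ∀ s t, f (s * t) = (σ (DS.incl K A s) ⊗ₜ[K] 1) * f t + f s * (1 ⊗ₜ[K] DS.incl K A t))
    (hl : ∀ s δ, g (innerL K A s δ)
      = (σ (DS.incl K A s) ⊗ₜ[K] 1) * g δ + f s * (1 ⊗ₜ[K] DS.gen K A δ))
    (hr : ∀ δ t, g (innerR K A t δ)
      = (σ (DS.gen K A δ) ⊗ₜ[K] 1) * f t + g δ * (1 ⊗ₜ[K] DS.incl K A t)) :
    ∃ F : DS K A →ₗ[K] DS K A ⊗[K] DS K A, IsOuterDer σ F ∧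
      (∀ s, F (DS.incl K A s) = f s) ∧ ∀ δ, F (DS.gen K A δ) = g δ := by
  have h1 : f 1 = 0 := by simpa [← Algebra.TensorProduct.one_def] using hf 1 1
  let φ : A →ₐ[K] Matrix (Fin 2) (Fin 2) (DS K A ⊗[K] DS K A) :=
    AlgHom.ofLinearMap
      { toFun := fun s => tri σ (DS.incl K A s) (f s)
        map_add' := fun s t => by
          ext i j; fin_cases i <;> fin_cases j <;>
            simp [tri, TensorProduct.add_tmul, TensorProduct.tmul_add]
        map_smul' := fun c s => by
          ext i j; fin_cases i <;> fin_cases j <;>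
            simp [tri, TensorProduct.smul_tmul'] }
      (by ext i j; fin_cases i <;> fin_cases j <;>
            simp [tri, h1, ← Algebra.TensorProduct.one_def])
      (fun s t => by
        change tri σ _ _ = tri σ _ _ * tri σ _ _
        rw [tri_mul, ← hf, map_mul])
  let γ : DoubleDer K A →ₗ[K] Matrix (Fin 2) (Fin 2) (DS K A ⊗[K] DS K A) :=
      { toFun := fun δ => tri σ (DS.gen K A δ) (g δ)
        map_add' := fun s t => by
          ext i j; fin_cases i <;> fin_cases j <;>
            simp [tri, TensorProduct.add_tmul, TensorProduct.tmul_add]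
        map_smul' := fun c s => by
          ext i j; fin_cases i <;> fin_cases j <;>
            simp [tri, TensorProduct.smul_tmul'] }
  let Φ := DS.lift φ γ
    (fun s δ => by
      change tri σ _ _ = tri σ _ _ * tri σ _ _
      rw [tri_mul, ← hl, DS.gen_innerL])
    (fun δ t => by
      change tri σ _ _ = tri σ _ _ * tri σ _ _
      rw [tri_mul, ← hr, DS.gen_innerR])
  have hi : ∀ s, Φ (DS.incl K A s) = tri σ (DS.incl K A s) (f s) := DS.lift_incl _ _ _ _
  have hg : ∀ δ, Φ (DS.gen K A δ) = tri σ (DS.gen K A δ) (g δ) := DS.lift_gen _ _ _ _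
  have hΦ : ∀ x, ∃ w, Φ x = tri σ x w := by
    intro x
    induction x using DS.induction with
    | hi s => exact ⟨_, hi s⟩
    | hg δ => exact ⟨_, hg δ⟩
    | hm x y h1 h2 =>
      obtain ⟨w, hw⟩ := h1
      obtain ⟨z, hz⟩ := h2
      exact ⟨_, by rw [map_mul, hw, hz, tri_mul]⟩
    | ha x y h1 h2 =>
      obtain ⟨w, hw⟩ := h1
      obtain ⟨z, hz⟩ := h2
      refine ⟨w + z, ?_⟩
      rw [map_add, hw, hz]
      ext i j; fin_cases i <;> fin_cases j <;>
        simp [tri, TensorProduct.add_tmul, TensorProduct.tmul_add]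
  refine ⟨{ toFun := fun x => Φ x 0 1, map_add' := fun x y => by simp,
            map_smul' := fun c x => by simp }, ?_, ?_, ?_⟩
  · intro x y
    obtain ⟨w, hw⟩ := hΦ x
    obtain ⟨z, hz⟩ := hΦ y
    simp only [LinearMap.coe_mk, AddHom.coe_mk, map_mul, hw, hz, tri_mul]
    simp [tri]
  · intro s
    simp only [LinearMap.coe_mk, AddHom.coe_mk, hi]
    simp [tri]
  · intro s
    simp only [LinearMap.coe_mk, AddHom.coe_mk, hg]
    simp [tri]

end mkOuter

end OuterDerivations

section Bracket

variable {K A}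

/-- The flip `x ⊗ y ↦ y ⊗ x` of `𝔻A ⊗ 𝔻A`. -/
def flip : DS K A ⊗[K] DS K A →ₐ[K] DS K A ⊗[K] DS K A :=
  (Algebra.TensorProduct.comm K (DS K A) (DS K A)).toAlgHom

@[simp] theorem flip_tmul (x y : DS K A) : flip (x ⊗ₜ[K] y) = y ⊗ₜ[K] x := rfl

@[simp] theorem flip_flip (z : DS K A ⊗[K] DS K A) : flip (flip z) = z :=
  (TensorProduct.comm K (DS K A) (DS K A)).symm_apply_apply z

/-- `{{s, -}}` for an element `s` of `A`. -/
theorem exists_brIncl (s : A) :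
    ∃ F : DS K A →ₗ[K] DS K A ⊗[K] DS K A, IsOuterDer (DS.parity K A) F ∧
      (∀ t, F (DS.incl K A t) = 0) ∧ ∀ Δ, F (DS.gen K A Δ) = -flip (inclTwo (Δ.1 s)) :=
  exists_outerDer (DS.parity K A) 0
    { toFun := fun Δ => -flip (inclTwo (Δ.1 s))
      map_add' := fun Δ Γ => by simp; abel
      map_smul' := fun c Δ => by simp }
    (fun s t => by simp)
    (fun t Δ => by simp)
    (fun Δ t => by simp)

variable [Module.Finite K A]

/-- The double Schouten bracket `{{δ, Δ}} = {{δ, Δ}}_l + {{δ, Δ}}_r` of two double derivations, as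
an element of `𝔻A ⊗ 𝔻A`. -/
noncomputable def genBr (δ Δ : DoubleDer K A) : DS K A ⊗[K] DS K A :=
  TensorProduct.map (DS.gen K A) (DS.incl K A).toLinearMap (schoutenL δ Δ)
    + TensorProduct.map (DS.incl K A).toLinearMap (DS.gen K A) (schoutenR δ Δ)

theorem map_schoutenL (δ Δ : DoubleDer K A) :
    TensorProduct.map (DS.gen K A) (DS.incl K A).toLinearMap (schoutenL δ Δ)
      = -flip (TensorProduct.map (DS.incl K A).toLinearMap (DS.gen K A) (schoutenR Δ δ)) := by
  rw [schoutenL, map_smul, neg_smul, one_smul]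
  congr 1
  generalize schoutenR Δ δ = z
  induction z using TensorProduct.induction_on with
  | zero => simp
  | tmul u v => simp
  | add u v hu hv => simp only [map_add, hu, hv]

theorem flip_genBr (δ Δ : DoubleDer K A) : flip (genBr δ Δ) = -genBr Δ δ := by
  simp only [genBr, map_schoutenL, map_add, map_neg, flip_flip]; abel

theorem genBr_add_right (δ Δ Γ : DoubleDer K A) : genBr δ (Δ + Γ) = genBr δ Δ + genBr δ Γ := by
  simp only [genBr, map_schoutenL, schoutenR_add_right, schoutenR_add_left, map_add]; abel

theorem genBr_smul_right (c : K) (δ Δ : DoubleDer K A) : genBr δ (c • Δ) = c • genBr δ Δ := by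
  simp only [genBr, map_schoutenL, schoutenR_smul_right, schoutenR_smul_left, map_smul, smul_add,
    smul_neg]

theorem genBr_add_left (δ Δ Γ : DoubleDer K A) : genBr (δ + Δ) Γ = genBr δ Γ + genBr Δ Γ := by
  simp only [genBr, map_schoutenL, schoutenR_add_right, schoutenR_add_left, map_add]; abel

theorem genBr_smul_left (c : K) (δ Δ : DoubleDer K A) : genBr (c • δ) Δ = c • genBr δ Δ := by
  simp only [genBr, map_schoutenL, schoutenR_smul_right, schoutenR_smul_left, map_smul, smul_add,
    smul_neg]

theorem genBr_innerL (δ Δ : DoubleDer K A) (s : A) :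
    genBr δ (innerL K A s Δ) = (DS.incl K A s ⊗ₜ[K] 1) * genBr δ Δ
      + inclTwo (δ.1 s) * (1 ⊗ₜ[K] DS.gen K A Δ) := by
  have e1 : ∀ z : A ⊗[K] DoubleDer K A,
      TensorProduct.map (DS.incl K A).toLinearMap (DS.gen K A)
        (LinearMap.rTensor _ (LinearMap.mulLeft K s) z)
      = (DS.incl K A s ⊗ₜ[K] 1)
        * TensorProduct.map (DS.incl K A).toLinearMap (DS.gen K A) z := by
    intro z
    induction z using TensorProduct.induction_on with
    | zero => simp
    | tmul u v => simp
    | add u v hu hv => simp only [map_add, hu, hv, mul_add]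
  have e2 : ∀ w : A ⊗[K] A,
      TensorProduct.map (DS.incl K A).toLinearMap (DS.gen K A)
        (LinearMap.lTensor A ((innerL K A).flip Δ) w)
      = inclTwo w * (1 ⊗ₜ[K] DS.gen K A Δ) := by
    intro w
    induction w using TensorProduct.induction_on with
    | zero => simp
    | tmul u v => simp [DS.gen_innerL]
    | add u v hu hv => simp only [map_add, hu, hv, add_mul]
  have e3 : ∀ z : A ⊗[K] DoubleDer K A,
      flip (TensorProduct.map (DS.incl K A).toLinearMap (DS.gen K A)
        (LinearMap.lTensor A (innerL K A s) z))
      = (DS.incl K A s ⊗ₜ[K] 1)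
        * flip (TensorProduct.map (DS.incl K A).toLinearMap (DS.gen K A) z) := by
    intro z
    induction z using TensorProduct.induction_on with
    | zero => simp
    | tmul u v => simp [DS.gen_innerL]
    | add u v hu hv => simp only [map_add, hu, hv, mul_add]
  simp only [genBr, map_schoutenL, schoutenR_innerL, schoutenR_innerL_left, map_add, e1, e2, e3,
    mul_add, mul_neg]
  abel

theorem genBr_innerR (δ Δ : DoubleDer K A) (t : A) :
    genBr δ (innerR K A t Δ) = (DS.gen K A Δ ⊗ₜ[K] 1) * inclTwo (δ.1 t)
      + genBr δ Δ * (1 ⊗ₜ[K] DS.incl K A t) := by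
  have e1 : ∀ z : A ⊗[K] DoubleDer K A,
      flip (TensorProduct.map (DS.incl K A).toLinearMap (DS.gen K A)
        (LinearMap.rTensor _ (LinearMap.mulRight K t) z))
      = flip (TensorProduct.map (DS.incl K A).toLinearMap (DS.gen K A) z)
        * (1 ⊗ₜ[K] DS.incl K A t) := by
    intro z
    induction z using TensorProduct.induction_on with
    | zero => simp
    | tmul u v => simp
    | add u v hu hv => simp only [map_add, hu, hv, add_mul]
  have e2 : ∀ w : A ⊗[K] A,
      flip (TensorProduct.map (DS.incl K A).toLinearMap (DS.gen K A)
        (LinearMap.lTensor A ((innerR K A).flip Δ) (TensorProduct.comm K A A w)))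
      = (DS.gen K A Δ ⊗ₜ[K] 1) * inclTwo w := by
    intro w
    induction w using TensorProduct.induction_on with
    | zero => simp
    | tmul u v => simp [DS.gen_innerR]
    | add u v hu hv => simp only [map_add, hu, hv, mul_add]
  have e3 : ∀ z : A ⊗[K] DoubleDer K A,
      TensorProduct.map (DS.incl K A).toLinearMap (DS.gen K A)
        (LinearMap.lTensor A (innerR K A t) z)
      = TensorProduct.map (DS.incl K A).toLinearMap (DS.gen K A) z
        * (1 ⊗ₜ[K] DS.incl K A t) := by
    intro z
    induction z using TensorProduct.induction_on with
    | zero => simp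
    | tmul u v => simp [DS.gen_innerR]
    | add u v hu hv => simp only [map_add, hu, hv, add_mul]
  have h := congrArg (fun z => flip (TensorProduct.map (DS.incl K A).toLinearMap (DS.gen K A) z))
    (schoutenR_innerR_left Δ δ t)
  simp only [map_add, e1, e2] at h
  simp only [genBr, map_schoutenL, schoutenR_innerR, e3, add_mul, neg_mul, ← h]
  abel

/-- `{{δ, -}}` for a double derivation `δ`. -/
theorem exists_brGen (δ : DoubleDer K A) :
    ∃ F : DS K A →ₗ[K] DS K A ⊗[K] DS K A, IsOuterDer (AlgHom.id K _) F ∧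
      (∀ s, F (DS.incl K A s) = inclTwo (δ.1 s)) ∧ ∀ Δ, F (DS.gen K A Δ) = genBr δ Δ :=
  exists_outerDer (AlgHom.id K _) (inclTwo.toLinearMap ∘ₗ δ.1)
    { toFun := genBr δ, map_add' := genBr_add_right δ, map_smul' := fun c => genBr_smul_right c δ }
    (fun s t => by simp [DoubleDer.leibniz])
    (fun s Δ => genBr_innerL δ Δ s)
    (fun Δ t => genBr_innerR δ Δ t)

end Bracket

section Schouten

variable {K A}

/-- The left inner action of `𝔻A` on `𝔻A ⊗ 𝔻A` with Koszul signs: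
`a * (u ⊗ v) = (-1) ^ (|a| |u|) u ⊗ a v`. -/
def innerLeft : DS K A →ₐ[K] Module.End K (DS K A ⊗[K] DS K A) :=
  DS.lift
    ((Algebra.lmul K (DS K A ⊗[K] DS K A)).comp
      ((Algebra.TensorProduct.includeRight).comp (DS.incl K A)))
    { toFun := fun δ => LinearMap.mulLeft K ((1 : DS K A) ⊗ₜ[K] DS.gen K A δ) ∘ₗ
        (Algebra.TensorProduct.map (DS.parity K A) (AlgHom.id K (DS K A))).toLinearMap
      map_add' := fun δ Δ => by ext; simp [TensorProduct.tmul_add, add_mul]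
      map_smul' := fun c δ => by ext; simp }
    (fun s δ => by ext; simp [DS.gen_innerL, mul_assoc])
    (fun δ t => by ext; simp [DS.gen_innerR, mul_assoc])

theorem innerLeft_incl (s : A) (z : DS K A ⊗[K] DS K A) :
    innerLeft (DS.incl K A s) z = (1 ⊗ₜ[K] DS.incl K A s) * z :=
  DFunLike.congr_fun (DS.lift_incl _ _ _ _ s) z

theorem innerLeft_gen (δ : DoubleDer K A) (z : DS K A ⊗[K] DS K A) :
    innerLeft (DS.gen K A δ) z = (1 ⊗ₜ[K] DS.gen K A δ)
      * Algebra.TensorProduct.map (DS.parity K A) (AlgHom.id K (DS K A)) z :=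
  DFunLike.congr_fun (DS.lift_gen _ _ _ _ δ) z

/-- The right action of an element `s` of `A` on maps `F : 𝔻A → 𝔻A ⊗ 𝔻A`,
`(F · s)(c) = F(c)' s ⊗ F(c)''`. -/
def rightIncl (s : A) : Module.End K (DS K A →ₗ[K] DS K A ⊗[K] DS K A) where
  toFun F := LinearMap.mulRight K (DS.incl K A s ⊗ₜ[K] (1 : DS K A)) ∘ₗ F
  map_add' F G := by ext; simp [add_mul]
  map_smul' c F := by ext; simp

/-- The right action of a double derivation `δ` on maps `F : 𝔻A → 𝔻A ⊗ 𝔻A`,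
`(F · δ)(c) = (-1) ^ (|c| - 1) (-1) ^ |F(c)''| F(c)' δ ⊗ F(c)''`. -/
def rightGen (δ : DoubleDer K A) : Module.End K (DS K A →ₗ[K] DS K A ⊗[K] DS K A) where
  toFun F := -(LinearMap.mulRight K (DS.gen K A δ ⊗ₜ[K] (1 : DS K A)) ∘ₗ
    (Algebra.TensorProduct.map (AlgHom.id K (DS K A)) (DS.parity K A)).toLinearMap ∘ₗ
      F ∘ₗ (DS.parity K A).toLinearMap)
  map_add' F G := by ext; simp [add_mul]; abel
  map_smul' c F := by ext; simp

theorem rightIncl_apply (s : A) (F : DS K A →ₗ[K] DS K A ⊗[K] DS K A) (c : DS K A) :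
    rightIncl s F c = F c * (DS.incl K A s ⊗ₜ[K] 1) := rfl

theorem rightGen_apply (δ : DoubleDer K A) (F : DS K A →ₗ[K] DS K A ⊗[K] DS K A) (c : DS K A) :
    rightGen δ F c = -(Algebra.TensorProduct.map (AlgHom.id K (DS K A)) (DS.parity K A)
      (F (DS.parity K A c)) * (DS.gen K A δ ⊗ₜ[K] 1)) := rfl

theorem map_mul_one_tmul (z : DS K A ⊗[K] DS K A) (x : DS K A) :
    Algebra.TensorProduct.map (AlgHom.id K (DS K A)) (DS.parity K A) (z * (x ⊗ₜ[K] 1))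
      = Algebra.TensorProduct.map (AlgHom.id K (DS K A)) (DS.parity K A) z * (x ⊗ₜ[K] 1) := by
  rw [map_mul, Algebra.TensorProduct.map_tmul, map_one, AlgHom.id_apply]

/-- The right action of `𝔻A` on maps `F : 𝔻A → 𝔻A ⊗ 𝔻A` given by
`(F · b)(c) = (-1) ^ (|b| (|c| - 1)) F(c) * b`, where
`(u ⊗ v) * b = (-1) ^ (|b| |v|) u b ⊗ v`. -/
def innerRight : DS K A →ₐ[K] (Module.End K (DS K A →ₗ[K] DS K A ⊗[K] DS K A))ᵐᵒᵖ :=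
  DS.lift
    (AlgHom.ofLinearMap
      { toFun := fun s => MulOpposite.op (rightIncl s)
        map_add' := fun s t => by
          apply MulOpposite.unop_injective
          refine LinearMap.ext fun F => LinearMap.ext fun c => ?_
          simp [rightIncl_apply, TensorProduct.add_tmul, mul_add]
        map_smul' := fun r s => by
          apply MulOpposite.unop_injective
          refine LinearMap.ext fun F => LinearMap.ext fun c => ?_
          simp [rightIncl_apply, ← TensorProduct.smul_tmul'] }
      (by
        apply MulOpposite.unop_injective
        refine LinearMap.ext fun F => LinearMap.ext fun c => ?_
        simp [rightIncl_apply, ← Algebra.TensorProduct.one_def])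
      (fun s t => by
        apply MulOpposite.unop_injective
        refine LinearMap.ext fun F => LinearMap.ext fun c => ?_
        simp [rightIncl_apply, mul_assoc]))
    { toFun := fun δ => MulOpposite.op (rightGen δ)
      map_add' := fun s t => by
        apply MulOpposite.unop_injective
        refine LinearMap.ext fun F => LinearMap.ext fun c => ?_
        simp [rightGen_apply, TensorProduct.add_tmul, mul_add]; abel
      map_smul' := fun r s => by
        apply MulOpposite.unop_injective
        refine LinearMap.ext fun F => LinearMap.ext fun c => ?_
        simp [rightGen_apply, ← TensorProduct.smul_tmul'] }
    (fun s δ => by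
      apply MulOpposite.unop_injective
      refine LinearMap.ext fun F => LinearMap.ext fun c => ?_
      simp [rightGen_apply, rightIncl_apply, map_mul_one_tmul, DS.gen_innerL, mul_assoc])
    (fun δ t => by
      apply MulOpposite.unop_injective
      refine LinearMap.ext fun F => LinearMap.ext fun c => ?_
      simp [rightGen_apply, rightIncl_apply, DS.gen_innerR, mul_assoc])

theorem innerRight_incl (s : A) :
    innerRight (DS.incl K A s) = MulOpposite.op (rightIncl s) := DS.lift_incl _ _ _ _ s

theorem innerRight_gen (δ : DoubleDer K A) :
    innerRight (DS.gen K A δ) = MulOpposite.op (rightGen δ) := DS.lift_gen _ _ _ _ δ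

theorem map_left_mul (x : DS K A) (z w : DS K A ⊗[K] DS K A) :
    Algebra.TensorProduct.map (DS.parity K A) (AlgHom.id K (DS K A)) ((x ⊗ₜ[K] 1) * z
        + w * (1 ⊗ₜ[K] x))
      = (DS.parity K A x ⊗ₜ[K] 1)
          * Algebra.TensorProduct.map (DS.parity K A) (AlgHom.id K (DS K A)) z
        + Algebra.TensorProduct.map (DS.parity K A) (AlgHom.id K (DS K A)) w * (1 ⊗ₜ[K] x) := by
  simp

theorem one_tmul_mul_tmul_one (x y : DS K A) :
    ((1 : DS K A) ⊗ₜ[K] x) * (y ⊗ₜ[K] 1) = (y ⊗ₜ[K] 1) * (1 ⊗ₜ[K] x) := by simp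

namespace IsOuterDer

variable {σ : DS K A →ₐ[K] DS K A} {F : DS K A →ₗ[K] DS K A ⊗[K] DS K A}

theorem left_incl (hF : IsOuterDer σ F) (s : A) :
    IsOuterDer σ (innerLeft (DS.incl K A s) ∘ₗ F) := fun x y => by
  simp only [LinearMap.comp_apply, innerLeft_incl, hF x y, mul_add, ← mul_assoc,
    one_tmul_mul_tmul_one]

theorem left_gen (hF : IsOuterDer σ F) (δ : DoubleDer K A) :
    IsOuterDer ((DS.parity K A).comp σ) (innerLeft (DS.gen K A δ) ∘ₗ F) := fun x y => by
  simp only [LinearMap.comp_apply, innerLeft_gen, hF x y, ← mul_assoc, map_add, map_mul,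
    Algebra.TensorProduct.map_tmul, map_one, AlgHom.id_apply, one_tmul_mul_tmul_one,
    AlgHom.comp_apply]

theorem right_incl (hF : IsOuterDer σ F) (s : A) : IsOuterDer σ (rightIncl s F) := fun x y => by
  simp only [rightIncl_apply, hF x y, add_mul, mul_assoc, one_tmul_mul_tmul_one]

theorem right_gen (hF : IsOuterDer σ F) (δ : DoubleDer K A) :
    IsOuterDer (σ.comp (DS.parity K A)) (rightGen δ F) := fun x y => by
  rw [rightGen_apply, rightGen_apply, rightGen_apply, map_mul, hF]
  simp only [map_mul, map_add, Algebra.TensorProduct.map_tmul, map_one,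
    AlgHom.id_apply, add_mul, mul_assoc, one_tmul_mul_tmul_one, AlgHom.comp_apply,
    DS.parity_parity, neg_add, mul_neg, neg_mul]

end IsOuterDer

theorem parity_comp_parity : (DS.parity K A).comp (DS.parity K A) = AlgHom.id K _ := by
  ext x; simp

/-- The left and right actions on maps `𝔻A → 𝔻A ⊗ 𝔻A` commute. -/
theorem left_right (x y : DS K A) (F : DS K A →ₗ[K] DS K A ⊗[K] DS K A) :
    innerLeft x ∘ₗ (innerRight y).unop F = (innerRight y).unop (innerLeft x ∘ₗ F) := by
  induction x using DS.induction generalizing F with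
  | ha x x' h h' => simp only [map_add, LinearMap.add_comp, h, h']
  | hm x x' h h' =>
    simp only [map_mul, Module.End.mul_eq_comp, LinearMap.comp_assoc, h, h']
  | hi s =>
    induction y using DS.induction generalizing F with
    | ha y y' h h' => simp only [map_add, MulOpposite.unop_add, LinearMap.add_apply,
        LinearMap.comp_add, h, h']
    | hm y y' h h' => simp only [map_mul, MulOpposite.unop_mul, Module.End.mul_apply, h, h']
    | hi t =>
      ext c
      simp [innerRight_incl, rightIncl_apply, innerLeft_incl, mul_assoc]
    | hg Δ =>
      ext c
      simp [innerRight_gen, rightGen_apply, innerLeft_incl, mul_assoc]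
  | hg δ =>
    induction y using DS.induction generalizing F with
    | ha y y' h h' => simp only [map_add, MulOpposite.unop_add, LinearMap.add_apply,
        LinearMap.comp_add, h, h']
    | hm y y' h h' => simp only [map_mul, MulOpposite.unop_mul, Module.End.mul_apply, h, h']
    | hi t =>
      ext c
      simp [innerRight_incl, rightIncl_apply, innerLeft_gen, mul_assoc]
    | hg Δ =>
      ext c
      simp only [innerRight_gen, rightGen_apply, innerLeft_gen, MulOpposite.unop_op,
        LinearMap.comp_apply, map_neg, map_mul]
      generalize F (DS.parity K A c) = z
      induction z using TensorProduct.induction_on with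
      | zero => simp
      | tmul u v => simp [TensorProduct.neg_tmul, TensorProduct.tmul_neg]
      | add u v hu hv => simp only [map_add, mul_add, add_mul, neg_add, hu, hv]

variable [Module.Finite K A]

/-- The existence of the double Schouten bracket. -/
theorem exists_schouten :
    ∃ B : DS K A →ₗ[K] DS K A →ₗ[K] DS K A ⊗[K] DS K A,
      (∀ a b, B (a * b) = innerLeft a ∘ₗ B b + (innerRight b).unop (B a)) ∧
      (∀ s, IsOuterDer (DS.parity K A) (B (DS.incl K A s))) ∧
      (∀ δ, IsOuterDer (AlgHom.id K _) (B (DS.gen K A δ))) ∧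
      (∀ s t, B (DS.incl K A s) (DS.incl K A t) = 0) ∧
      (∀ δ s, B (DS.gen K A δ) (DS.incl K A s) = inclTwo (δ.1 s)) ∧
      (∀ s δ, B (DS.incl K A s) (DS.gen K A δ) = -flip (inclTwo (δ.1 s))) ∧
      (∀ δ Δ, B (DS.gen K A δ) (DS.gen K A Δ) = genBr δ Δ) := by
  choose bi bi1 bi2 bi3 using exists_brIncl (K := K) (A := A)
  choose bg bg1 bg2 bg3 using exists_brGen (K := K) (A := A)
  -- the relations of the tensor algebra in the first argument
  have hmul : ∀ s t, bi (s * t) = innerLeft (DS.incl K A s) ∘ₗ bi t + rightIncl t (bi s) := by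
    intro s t
    refine (bi1 _).eq (((bi1 t).left_incl s).add ((bi1 s).right_incl t)) (fun u => ?_) fun Δ => ?_
    · simp [bi2, innerLeft_incl, rightIncl_apply]
    · simp [bi3, innerLeft_incl, rightIncl_apply, DoubleDer.leibniz]; abel
  have hl : ∀ s δ, bg (innerL K A s δ)
      = innerLeft (DS.incl K A s) ∘ₗ bg δ + rightGen δ (bi s) := by
    intro s δ
    have h2 : IsOuterDer (AlgHom.id K _) (rightGen δ (bi s)) :=
      parity_comp_parity (K := K) (A := A) ▸ (bi1 s).right_gen δ
    refine (bg1 _).eq (((bg1 δ).left_incl s).add h2) (fun u => ?_) fun Δ => ?_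
    · simp [bg2, bi2, innerLeft_incl, rightGen_apply]
    · have h := flip_genBr Δ (innerL K A s δ)
      rw [genBr_innerL, map_add, map_mul, map_mul, flip_genBr] at h
      simp only [bg3, bi3, LinearMap.add_apply, LinearMap.comp_apply, innerLeft_incl,
        rightGen_apply, DS.parity_gen, map_neg]
      rw [← neg_eq_iff_eq_neg] at h
      rw [← h]
      have h3 : ∀ w : A ⊗[K] A,
        Algebra.TensorProduct.map (AlgHom.id K (DS K A)) (DS.parity K A) (flip (inclTwo w))
          = flip (inclTwo w) := by
        intro w
        induction w using TensorProduct.induction_on with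
        | zero => simp
        | tmul u v => simp
        | add u v hu hv => simp only [map_add, hu, hv]
      simp only [h3, flip_tmul]
      simp [add_comm]
  have hr : ∀ δ t, bg (innerR K A t δ)
      = innerLeft (DS.gen K A δ) ∘ₗ bi t + rightIncl t (bg δ) := by
    intro δ s
    have h2 : IsOuterDer (AlgHom.id K _) (innerLeft (DS.gen K A δ) ∘ₗ bi s) :=
      parity_comp_parity (K := K) (A := A) ▸ (bi1 s).left_gen δ
    refine (bg1 _).eq (h2.add ((bg1 δ).right_incl s)) (fun u => ?_) fun Δ => ?_
    · simp [bg2, bi2, rightIncl_apply]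
    · have h := flip_genBr Δ (innerR K A s δ)
      rw [genBr_innerR, map_add, map_mul, map_mul, flip_genBr] at h
      simp only [bg3, bi3, LinearMap.add_apply, LinearMap.comp_apply, innerLeft_gen,
        rightIncl_apply, map_neg]
      rw [← neg_eq_iff_eq_neg] at h
      rw [← h]
      have h3 : ∀ w : A ⊗[K] A,
        Algebra.TensorProduct.map (DS.parity K A) (AlgHom.id K (DS K A)) (flip (inclTwo w))
          = flip (inclTwo w) := by
        intro w
        induction w using TensorProduct.induction_on with
        | zero => simp
        | tmul u v => simp
        | add u v hu hv => simp only [map_add, hu, hv]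
      simp only [h3, flip_tmul]
      simp
      abel
  have biadd : ∀ s t, bi (s + t) = bi s + bi t := fun s t =>
    (bi1 _).eq ((bi1 s).add (bi1 t)) (fun u => by simp [bi2]) fun Δ => by
      simp [bi3]; abel
  have bismul : ∀ (r : K) s, bi (r • s) = r • bi s := fun r s =>
    (bi1 _).eq ((bi1 s).smul r) (fun u => by simp [bi2]) fun Δ => by simp [bi3]
  have bgadd : ∀ s t, bg (s + t) = bg s + bg t := fun s t =>
    (bg1 _).eq ((bg1 s).add (bg1 t)) (fun u => by simp [bg2]) fun Δ => by
      simp [bg3, genBr_add_left]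
  have bgsmul : ∀ (r : K) s, bg (r • s) = r • bg s := fun r s =>
    (bg1 _).eq ((bg1 s).smul r) (fun u => by simp [bg2]) fun Δ => by simp [bg3, genBr_smul_left]
  have bi_one : bi 1 = 0 := (bi1 1).eq (fun x y => by simp) (fun u => by simp [bi2]) fun Δ => by
    simp [bi3, DoubleDer.map_one]
  -- the extension of the first argument, through operators on `𝔻A × Hom(𝔻A, 𝔻A ⊗ 𝔻A)`
  let psi : DS K A → (DS K A →ₗ[K] DS K A ⊗[K] DS K A) →
      Module.End K (DS K A × (DS K A →ₗ[K] DS K A ⊗[K] DS K A)) := fun x L =>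
    { toFun := fun p => (x * p.1, innerLeft x ∘ₗ p.2 + (innerRight p.1).unop L)
      map_add' := fun p r => by
        refine Prod.ext (mul_add _ _ _) ?_
        simp only [Prod.snd_add, Prod.fst_add, map_add, LinearMap.comp_add, MulOpposite.unop_add,
          LinearMap.add_apply]
        abel
      map_smul' := fun c p => by
        refine Prod.ext (mul_smul_comm _ _ _) ?_
        simp only [Prod.smul_snd, Prod.smul_fst, map_smul, LinearMap.comp_smul,
          MulOpposite.unop_smul, LinearMap.smul_apply, RingHom.id_apply, smul_add] }
  have psi_apply : ∀ x L p, psi x L p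
      = (x * p.1, innerLeft x ∘ₗ p.2 + (innerRight p.1).unop L) := fun _ _ _ => rfl
  have psi_mul : ∀ x y L M, psi x L * psi y M
      = psi (x * y) (innerLeft x ∘ₗ M + (innerRight y).unop L) := by
    intro x y L M
    refine LinearMap.ext fun p => ?_
    simp only [psi_apply, map_mul, MulOpposite.unop_mul,
      Module.End.mul_eq_comp, LinearMap.comp_add, map_add, mul_assoc, left_right,
      LinearMap.comp_apply, LinearMap.comp_assoc, add_assoc]
  have psi_add : ∀ x y L M, psi (x + y) (L + M) = psi x L + psi y M := by
    intro x y L M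
    refine LinearMap.ext fun p => ?_
    simp only [LinearMap.add_apply, psi_apply, map_add, LinearMap.add_comp, add_mul,
      Prod.mk_add_mk]
    congr 1; abel
  have psi_smul : ∀ (c : K) x L, psi (c • x) (c • L) = c • psi x L := by
    intro c x L
    refine LinearMap.ext fun p => ?_
    simp only [LinearMap.smul_apply, psi_apply, map_smul, LinearMap.smul_comp, smul_mul_assoc,
      Prod.smul_mk, smul_add]
  let φ : A →ₐ[K] Module.End K (DS K A × (DS K A →ₗ[K] DS K A ⊗[K] DS K A)) :=
    AlgHom.ofLinearMap
      { toFun := fun s => psi (DS.incl K A s) (bi s)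
        map_add' := fun s t => by rw [map_add, biadd, psi_add]
        map_smul' := fun c s => by rw [map_smul, bismul, psi_smul, RingHom.id_apply] }
      (by
        refine LinearMap.ext fun p => ?_
        change psi _ _ p = p
        rw [psi_apply, bi_one]
        simp [Module.End.one_eq_id])
      (fun s t => by
        change psi _ _ = psi _ _ * psi _ _
        rw [psi_mul, hmul, map_mul, innerRight_incl, MulOpposite.unop_op])
  let γ : DoubleDer K A →ₗ[K] Module.End K (DS K A × (DS K A →ₗ[K] DS K A ⊗[K] DS K A)) :=
      { toFun := fun s => psi (DS.gen K A s) (bg s)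
        map_add' := fun s t => by rw [map_add, bgadd, psi_add]
        map_smul' := fun c s => by rw [map_smul, bgsmul, psi_smul, RingHom.id_apply] }
  let Ψ := DS.lift
    (R := Module.End K (DS K A × (DS K A →ₗ[K] DS K A ⊗[K] DS K A))) φ γ
    (fun s δ => by
      change psi _ _ = psi _ _ * psi _ _
      rw [psi_mul, hl, DS.gen_innerL, innerRight_gen, MulOpposite.unop_op])
    (fun δ t => by
      change psi _ _ = psi _ _ * psi _ _
      rw [psi_mul, hr, DS.gen_innerR, innerRight_incl, MulOpposite.unop_op])
  have hi : ∀ s, Ψ (DS.incl K A s) = psi (DS.incl K A s) (bi s) := DS.lift_incl _ _ _ _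
  have hg : ∀ δ, Ψ (DS.gen K A δ) = psi (DS.gen K A δ) (bg δ) := DS.lift_gen _ _ _ _
  have hΨ : ∀ x, ∃ w, Ψ x = psi x w := by
    intro x
    induction x using DS.induction with
    | hi s => exact ⟨_, hi s⟩
    | hg δ => exact ⟨_, hg δ⟩
    | hm x y h1 h2 =>
      obtain ⟨w, hw⟩ := h1
      obtain ⟨z, hz⟩ := h2
      exact ⟨_, by rw [map_mul, hw, hz, psi_mul]⟩
    | ha x y h1 h2 =>
      obtain ⟨w, hw⟩ := h1
      obtain ⟨z, hz⟩ := h2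
      exact ⟨_, by rw [map_add, hw, hz, psi_add]⟩
  have psi_one : ∀ x L, (psi x L (1, 0)).2 = L := by
    intro x L
    simp [psi_apply]
  let B : DS K A →ₗ[K] (DS K A →ₗ[K] DS K A ⊗[K] DS K A) :=
    { toFun := fun x => (Ψ x (1, 0)).2
      map_add' := fun x y => by simp
      map_smul' := fun c x => by simp }
  have hB : ∀ x, B x = (Ψ x (1, 0)).2 := fun _ => rfl
  have hBi : ∀ s, B (DS.incl K A s) = bi s := fun s => by rw [hB, hi, psi_one]
  have hBg : ∀ s, B (DS.gen K A s) = bg s := fun s => by rw [hB, hg, psi_one]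
  refine ⟨B, fun a b => ?_, fun s => hBi s ▸ bi1 s, fun δ => hBg δ ▸ bg1 δ,
    fun s t => by rw [hBi, bi2], fun δ s => by rw [hBg, bg2], fun s δ => by rw [hBi, bi3],
    fun δ Δ => by rw [hBg, bg3]⟩
  obtain ⟨w, hw⟩ := hΨ a
  obtain ⟨z, hz⟩ := hΨ b
  simp only [hB, map_mul, hw, hz, psi_mul, psi_one]

end Schouten

section Degree

variable {K A}

/-- Monomials of degree `n` in `𝔻A`: products of elements of `A` and of `n` double derivations. -/
inductive IsMonomial : ℕ → DS K A → Prop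
  | incl (s : A) : IsMonomial 0 (DS.incl K A s)
  | gen (δ : DoubleDer K A) : IsMonomial 1 (DS.gen K A δ)
  | mul {m n : ℕ} {x y : DS K A} : IsMonomial m x → IsMonomial n y → IsMonomial (m + n) (x * y)

variable (K A) in
/-- The homogeneous elements of degree `n` of `𝔻A`. -/
def degree (n : ℕ) : Submodule K (DS K A) := Submodule.span K {x | IsMonomial n x}

variable (K A) in
/-- The span `[𝔻A, 𝔻A]` of the graded commutators `a b - (-1) ^ (|a| |b|) b a`. -/
def commutators : Submodule K (DS K A) :=
  Submodule.span K {z | ∃ m n : ℕ, ∃ a ∈ degree K A m, ∃ b ∈ degree K A n,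
    z = a * b - (-1 : K) ^ (m * n) • (b * a)}

theorem IsMonomial.parity {n : ℕ} {x : DS K A} (h : IsMonomial n x) :
    DS.parity K A x = (-1 : K) ^ n • x := by
  induction h with
  | incl s => simp
  | gen δ => simp
  | mul _ _ h1 h2 => simp [h1, h2, pow_add, smul_smul, mul_comm]

theorem IsMonomial.parity_pow {n : ℕ} {x : DS K A} (h : IsMonomial n x) (k : ℕ) :
    (DS.parity K A ^ k) x = (-1 : K) ^ (k * n) • x := by
  induction k with
  | zero => simp
  | succ k ih =>
    rw [pow_succ, AlgHom.mul_apply, h.parity, map_smul, ih, smul_smul, ← pow_add]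
    congr 2; ring

theorem parity_mul_parity : DS.parity K A * DS.parity K A = 1 := parity_comp_parity

theorem IsOuterDer.left {k m : ℕ} {x : DS K A} (hx : IsMonomial m x)
    {F : DS K A →ₗ[K] DS K A ⊗[K] DS K A} (hF : IsOuterDer (DS.parity K A ^ k) F) :
    IsOuterDer (DS.parity K A ^ (k + m)) (innerLeft x ∘ₗ F) := by
  induction hx generalizing k F with
  | incl s => exact hF.left_incl s
  | gen δ => rw [pow_succ']; exact hF.left_gen δ
  | @mul m n x y _ _ h1 h2 =>
    rw [map_mul, Module.End.mul_eq_comp, LinearMap.comp_assoc, add_comm m n, ← add_assoc]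
    exact h1 (h2 hF)

theorem IsOuterDer.right {k m : ℕ} {x : DS K A} (hx : IsMonomial m x)
    {F : DS K A →ₗ[K] DS K A ⊗[K] DS K A} (hF : IsOuterDer (DS.parity K A ^ k) F) :
    IsOuterDer (DS.parity K A ^ (k + m)) ((innerRight x).unop F) := by
  induction hx generalizing k F with
  | incl s => rw [innerRight_incl]; exact hF.right_incl s
  | gen δ => rw [pow_succ, innerRight_gen]; exact hF.right_gen δ
  | mul _ _ h1 h2 =>
    rw [map_mul, MulOpposite.unop_mul, Module.End.mul_apply, ← add_assoc]
    exact h2 (h1 hF)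

end Degree

section SchoutenDef

variable {K A}

/-- The flip with Koszul sign, `u ⊗ v ↦ (-1) ^ (|u| |v|) v ⊗ u`. -/
noncomputable def koszulFlip : DS K A ⊗[K] DS K A →ₗ[K] DS K A ⊗[K] DS K A :=
  flip.toLinearMap ∘ₗ (LinearMap.id - (2⁻¹ : K) • TensorProduct.map
    (LinearMap.id - (DS.parity K A).toLinearMap) (LinearMap.id - (DS.parity K A).toLinearMap))

theorem koszulFlip_tmul (u v : DS K A) : koszulFlip (u ⊗ₜ[K] v) = v ⊗ₜ[K] u
    - (2⁻¹ : K) • ((v - DS.parity K A v) ⊗ₜ[K] (u - DS.parity K A u)) := by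
  simp [koszulFlip]

theorem koszulFlip_inclTwo (w : A ⊗[K] A) : koszulFlip (inclTwo w) = flip (inclTwo w) := by
  induction w using TensorProduct.induction_on with
  | zero => simp
  | add u v hu hv => simp only [map_add, hu, hv]
  | tmul u v => simp [koszulFlip_tmul]

section KoszulFlip

variable [CharZero K]

theorem koszulFlip_koszulFlip (z : DS K A ⊗[K] DS K A) : koszulFlip (koszulFlip z) = z := by
  induction z using TensorProduct.induction_on with
  | zero => simp
  | add u v hu hv => simp only [map_add, hu, hv]
  | tmul u v =>
    simp only [koszulFlip_tmul, map_sub, map_smul, DS.parity_parity]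
    have e : ∀ x : DS K A, x - DS.parity K A x - (DS.parity K A x - x)
        = (2 : K) • (x - DS.parity K A x) := fun x => by rw [two_smul]; abel
    rw [e, e, TensorProduct.smul_tmul_smul]
    module

theorem koszulFlip_left {m : ℕ} {x : DS K A} (hx : IsMonomial m x) (z : DS K A ⊗[K] DS K A) :
    koszulFlip ((x ⊗ₜ[K] 1) * z) = innerLeft x (koszulFlip z) := by
  induction hx generalizing z with
  | incl s =>
    rw [innerLeft_incl]
    induction z using TensorProduct.induction_on with
    | zero => simp
    | add u v hu hv => simp only [map_add, mul_add, hu, hv]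
    | tmul u v => simp [koszulFlip_tmul, mul_sub]
  | gen δ =>
    rw [innerLeft_gen]
    induction z using TensorProduct.induction_on with
    | zero => simp
    | add u v hu hv => simp only [map_add, mul_add, hu, hv]
    | tmul u v =>
      simp only [koszulFlip_tmul, Algebra.TensorProduct.tmul_mul_tmul, one_mul, map_sub, map_smul,
        Algebra.TensorProduct.map_tmul, DS.parity_parity, AlgHom.id_apply, mul_sub, map_mul,
        DS.parity_gen, mul_smul_comm, neg_mul, sub_neg_eq_add, TensorProduct.tmul_add,
        TensorProduct.tmul_sub, TensorProduct.sub_tmul]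
      module
  | @mul m n x y _ _ h1 h2 =>
    have : (x * y) ⊗ₜ[K] (1 : DS K A) = (x ⊗ₜ[K] 1) * (y ⊗ₜ[K] 1) := by simp
    rw [this, mul_assoc, h1, h2, map_mul, Module.End.mul_apply]

theorem innerRight_apply {m n : ℕ} {y b : DS K A} (hy : IsMonomial m y) (hb : IsMonomial n b)
    (F : DS K A →ₗ[K] DS K A ⊗[K] DS K A) : (innerRight y).unop F b
      = (-1 : K) ^ (m * (n + 1)) • koszulFlip (koszulFlip (F b) * (1 ⊗ₜ[K] y)) := by
  induction hy generalizing F with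
  | incl s =>
    rw [innerRight_incl, MulOpposite.unop_op, rightIncl_apply]
    rw [zero_mul, pow_zero, one_smul, ← koszulFlip_koszulFlip (F b * _)]
    congr 1
    generalize F b = z
    induction z using TensorProduct.induction_on with
    | zero => simp
    | add u v hu hv => simp only [map_add, add_mul, hu, hv]
    | tmul u v => simp [koszulFlip_tmul, sub_mul]
  | gen δ =>
    rw [innerRight_gen, MulOpposite.unop_op, rightGen_apply, hb.parity, map_smul, map_smul,
      smul_mul_assoc, ← smul_neg, one_mul, pow_succ, mul_smul, neg_smul, one_smul]
    congr 2
    rw [← koszulFlip_koszulFlip (_ * _)]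
    congr 1
    generalize F b = z
    induction z using TensorProduct.induction_on with
    | zero => simp
    | add u v hu hv => simp only [map_add, add_mul, hu, hv]
    | tmul u v =>
      simp only [koszulFlip_tmul, Algebra.TensorProduct.tmul_mul_tmul, mul_one, map_mul,
        Algebra.TensorProduct.map_tmul, DS.parity_parity, AlgHom.id_apply, sub_mul,
        DS.parity_gen, smul_mul_assoc, mul_neg, sub_neg_eq_add, TensorProduct.tmul_add,
        TensorProduct.tmul_sub, TensorProduct.sub_tmul]
      module
  | @mul m n x y _ _ h1 h2 =>
    rw [map_mul, MulOpposite.unop_mul, Module.End.mul_apply, h2, h1, map_smul,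
      koszulFlip_koszulFlip, smul_mul_assoc, map_smul, smul_smul, ← pow_add, mul_assoc]
    congr 2
    · ring
    · simp

end KoszulFlip

variable [Module.Finite K A]

theorem koszulFlip_genBr (δ Δ : DoubleDer K A) : koszulFlip (genBr δ Δ) = flip (genBr δ Δ) := by
  rw [genBr, map_add, map_add]
  congr 1
  · generalize schoutenL δ Δ = z
    induction z using TensorProduct.induction_on with
    | zero => simp
    | add u v hu hv => simp only [map_add, hu, hv]
    | tmul u v => simp [koszulFlip_tmul]
  · generalize schoutenR δ Δ = z
    induction z using TensorProduct.induction_on with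
    | zero => simp
    | add u v hu hv => simp only [map_add, hu, hv]
    | tmul u v => simp [koszulFlip_tmul]

variable (K A) in
/-- The double Schouten bracket on `𝔻A`. Its values on generators, the graded derivation property
and the graded antisymmetry, which determine it, are proved below. -/
noncomputable def schouten : DS K A →ₗ[K] DS K A →ₗ[K] DS K A ⊗[K] DS K A :=
  (exists_schouten (K := K) (A := A)).choose

theorem schouten_mul_left (a b : DS K A) : schouten K A (a * b)
    = innerLeft a ∘ₗ schouten K A b + (innerRight b).unop (schouten K A a) :=
  (exists_schouten (K := K) (A := A)).choose_spec.1 a b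

theorem schouten_incl_incl (s t : A) :
    schouten K A (DS.incl K A s) (DS.incl K A t) = 0 :=
  (exists_schouten (K := K) (A := A)).choose_spec.2.2.2.1 s t

theorem schouten_gen_incl (δ : DoubleDer K A) (s : A) :
    schouten K A (DS.gen K A δ) (DS.incl K A s) = inclTwo (δ.1 s) :=
  (exists_schouten (K := K) (A := A)).choose_spec.2.2.2.2.1 δ s

theorem schouten_incl_gen (s : A) (δ : DoubleDer K A) :
    schouten K A (DS.incl K A s) (DS.gen K A δ) = -flip (inclTwo (δ.1 s)) :=
  (exists_schouten (K := K) (A := A)).choose_spec.2.2.2.2.2.1 s δ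

theorem schouten_gen_gen (δ Δ : DoubleDer K A) :
    schouten K A (DS.gen K A δ) (DS.gen K A Δ)
      = TensorProduct.map (DS.gen K A) (DS.incl K A).toLinearMap (schoutenL δ Δ)
        + TensorProduct.map (DS.incl K A).toLinearMap (DS.gen K A) (schoutenR δ Δ) :=
  (exists_schouten (K := K) (A := A)).choose_spec.2.2.2.2.2.2 δ Δ

theorem IsMonomial.schouten {m : ℕ} {a : DS K A} (ha : IsMonomial m a) :
    IsOuterDer (DS.parity K A ^ (m + 1)) (schouten K A a) := by
  induction ha with
  | incl s =>
    rw [zero_add, pow_one]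
    exact (exists_schouten (K := K) (A := A)).choose_spec.2.1 s
  | gen δ =>
    rw [pow_succ, pow_one, parity_mul_parity]
    exact (exists_schouten (K := K) (A := A)).choose_spec.2.2.1 δ
  | @mul m n x y hx hy h1 h2 =>
    rw [schouten_mul_left]
    have e1 := h2.left hx
    have e2 := h1.right hy
    rw [show n + 1 + m = m + n + 1 by ring] at e1
    rw [show m + 1 + n = m + n + 1 by ring] at e2
    exact e1.add e2

/-- The graded derivation property
`{{a, b c}} = (-1) ^ ((|a| - 1) |b|) b {{a, c}} + {{a, b}} c`. -/
theorem schouten_mul_right {m n : ℕ} {a b : DS K A} (ha : a ∈ degree K A m)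
    (hb : b ∈ degree K A n) (c : DS K A) :
    schouten K A a (b * c) = (-1 : K) ^ ((m + 1) * n) • ((b ⊗ₜ[K] 1) * schouten K A a c)
      + schouten K A a b * (1 ⊗ₜ[K] c) := by
  induction ha using Submodule.span_induction with
  | zero => simp
  | add x y _ _ h1 h2 =>
    simp only [map_add, LinearMap.add_apply, h1, h2, mul_add, add_mul, smul_add]; abel
  | smul r x _ h1 =>
    simp only [map_smul, LinearMap.smul_apply, h1, smul_add, mul_smul_comm, smul_mul_assoc,
      smul_comm r]
  | mem a ha =>
    induction hb using Submodule.span_induction with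
    | zero => simp
    | add x y _ _ h1 h2 =>
      simp only [map_add, add_mul, h1, h2, TensorProduct.add_tmul, smul_add]; abel
    | smul r x _ h1 =>
      simp only [map_smul, smul_mul_assoc, h1, smul_add, smul_comm r, ← TensorProduct.smul_tmul']
    | mem b hb =>
      rw [ha.schouten b c, IsMonomial.parity_pow hb, ← TensorProduct.smul_tmul', smul_mul_assoc]

section Antisymmetry

variable [CharZero K]

theorem schouten_antisymm_step {m m' n : ℕ} {x y b : DS K A} (hx : IsMonomial m x)
    (hy : IsMonomial m' y) (hb : IsMonomial n b)
    (h1 : schouten K A x b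
      = -((-1 : K) ^ ((m + 1) * (n + 1)) • koszulFlip (schouten K A b x)))
    (h2 : schouten K A y b
      = -((-1 : K) ^ ((m' + 1) * (n + 1)) • koszulFlip (schouten K A b y))) :
    schouten K A (x * y) b
      = -((-1 : K) ^ ((m + m' + 1) * (n + 1)) • koszulFlip (schouten K A b (x * y))) := by
  rw [schouten_mul_left, LinearMap.add_apply, LinearMap.comp_apply, innerRight_apply hy hb, h1, h2,
    hb.schouten x y, hx.parity_pow, ← TensorProduct.smul_tmul', smul_mul_assoc, map_add, map_smul,
    koszulFlip_left hx, map_neg, map_smul, map_neg, map_smul, koszulFlip_koszulFlip, smul_add,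
    smul_smul, ← pow_add, neg_add, neg_mul, map_neg, smul_neg, smul_mul_assoc, map_smul, smul_smul,
    ← pow_add]
  have e1 : (-1 : K) ^ ((m + m' + 1) * (n + 1) + (n + 1) * m)
      = (-1 : K) ^ ((m' + 1) * (n + 1)) := by
    rw [show (m + m' + 1) * (n + 1) + (n + 1) * m = (m' + 1) * (n + 1) + 2 * ((n + 1) * m) by ring,
      pow_add, pow_mul (-1 : K) 2]
    simp
  rw [e1, show m' * (n + 1) + (m + 1) * (n + 1) = (m + m' + 1) * (n + 1) by ring]

theorem schouten_antisymm_swap {m n : ℕ} {x b : DS K A}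
    (h1 : schouten K A x b
      = -((-1 : K) ^ ((m + 1) * (n + 1)) • koszulFlip (schouten K A b x))) :
    schouten K A b x
      = -((-1 : K) ^ ((n + 1) * (m + 1)) • koszulFlip (schouten K A x b)) := by
  rw [h1, map_neg, map_smul, koszulFlip_koszulFlip, smul_neg, smul_smul, neg_neg,
    mul_comm (n + 1), ← mul_pow]
  simp

theorem IsMonomial.schouten_antisymm {m n : ℕ} {a b : DS K A} (ha : IsMonomial m a)
    (hb : IsMonomial n b) : DoublePoisson.schouten K A a b
      = -((-1 : K) ^ ((m + 1) * (n + 1)) • koszulFlip (DoublePoisson.schouten K A b a)) := by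
  have gg : ∀ δ Δ : DoubleDer K A, DoublePoisson.schouten K A (DS.gen K A δ) (DS.gen K A Δ)
      = genBr δ Δ := schouten_gen_gen
  induction ha with
  | mul hx hy h1 h2 => exact schouten_antisymm_step hx hy hb h1 h2
  | incl s =>
    apply schouten_antisymm_swap
    induction hb with
    | mul hx hy h1 h2 => exact schouten_antisymm_step hx hy (.incl s) h1 h2
    | incl t => simp [schouten_incl_incl]
    | gen δ =>
      rw [schouten_incl_gen, schouten_gen_incl, map_neg, ← koszulFlip_inclTwo,
        koszulFlip_koszulFlip]
      simp
  | gen δ =>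
    apply schouten_antisymm_swap
    induction hb with
    | mul hx hy h1 h2 => exact schouten_antisymm_step hx hy (.gen δ) h1 h2
    | incl t => rw [schouten_incl_gen, schouten_gen_incl, ← koszulFlip_inclTwo]; simp
    | gen Δ =>
      rw [gg, gg, koszulFlip_genBr, flip_genBr]
      norm_num

/-- The graded antisymmetry `{{a, b}} = -(-1) ^ ((|a| - 1) (|b| - 1)) σ₍₁₂₎ {{b, a}}`. -/
theorem schouten_antisymm {m n : ℕ} {a b : DS K A} (ha : a ∈ degree K A m)
    (hb : b ∈ degree K A n) : schouten K A a b
      = -((-1 : K) ^ ((m + 1) * (n + 1)) • koszulFlip (schouten K A b a)) := by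
  induction ha using Submodule.span_induction with
  | zero => simp
  | add x y _ _ h1 h2 => simp only [map_add, LinearMap.add_apply, h1, h2, smul_add, neg_add]
  | smul r x _ h1 => simp only [map_smul, LinearMap.smul_apply, h1, smul_comm r, smul_neg]
  | mem a ha =>
    induction hb using Submodule.span_induction with
    | zero => simp
    | add x y _ _ h1 h2 => simp only [map_add, LinearMap.add_apply, h1, h2, smul_add, neg_add]
    | smul r x _ h1 => simp only [map_smul, LinearMap.smul_apply, h1, smul_comm r, smul_neg]
    | mem b hb => exact IsMonomial.schouten_antisymm ha hb

end Antisymmetry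

variable (K A) in
/-- The bracket `{a, b}`: the image of `{{a, b}}` under the multiplication of `𝔻A`. -/
noncomputable def bracket (a b : DS K A) : DS K A :=
  LinearMap.mul' K (DS K A) (schouten K A a b)

end SchoutenDef

section Induced

variable {K A}

/-- The bilinear map `(u ⊗ v, w ⊗ z) ↦ w v ⊗ u z`. -/
def crossMul : A ⊗[K] A →ₗ[K] A ⊗[K] A →ₗ[K] A ⊗[K] A :=
  TensorProduct.lift (LinearMap.mk₂ K
    (fun u v => TensorProduct.map (LinearMap.mulRight K v) (LinearMap.mulLeft K u))
    (fun u u' v => by ext; simp [add_mul, TensorProduct.tmul_add])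
    (fun c u v => by ext; simp)
    (fun u v v' => by ext; simp [mul_add, TensorProduct.add_tmul])
    (fun c u v => by ext; simp [TensorProduct.smul_tmul']))

theorem crossMul_tmul (u v w z : A) :
    crossMul (u ⊗ₜ[K] v) (w ⊗ₜ[K] z) = (w * v) ⊗ₜ[K] (u * z) := rfl

/-- The double bracket on `A` induced by `P = δ Δ`:
`{{x, y}}_P = Δ(y)' δ(x)'' ⊗ δ(x)' Δ(y)'' - δ(y)' Δ(x)'' ⊗ Δ(x)' δ(y)''`. -/
def inducedBracket (δ Δ : DoubleDer K A) (x y : A) : A ⊗[K] A :=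
  crossMul (δ.1 x) (Δ.1 y) - crossMul (Δ.1 x) (δ.1 y)

end Induced

end General

section Semisimple

variable (K : Type*) [Field K] {k : ℕ}

/-- The semisimple algebra `S = M_{n₁}(K) ⊕ ⋯ ⊕ M_{n_k}(K)`. -/
abbrev S (n : Fin k → ℕ) : Type _ := ∀ i, Matrix (Fin (n i)) (Fin (n i)) K

variable (n : Fin k → ℕ)

/-- The matrix unit `e^i_{uv}` of the `i`-th summand of `S`. -/
def unit (i : Fin k) (u v : Fin (n i)) : S K n := Pi.single i (Matrix.single u v 1)

variable [∀ i, NeZero (n i)]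

/-- The generator `y^{ij}_{uv}` of `Der(S, S ⊗ S)` given by the arrow from the vertex `j` to the
vertex `i` with colour `(u, v) ∈ {1, …, n_j} × {1, …, n_i}`, namely the inner double derivation of
`e^j_{u1} ⊗ e^i_{1v}`. It satisfies `e^i_{11} · y^{ij}_{uv} · e^j_{11} = y^{ij}_{uv}`.
Indices start at `0` here. -/
def arrow (i j : Fin k) (u : Fin (n j)) (v : Fin (n i)) : DoubleDer K (S K n) :=
  innerDer (unit K n j u 0 ⊗ₜ[K] unit K n i 0 v)

/-- The cycle of length two `P = y^{pq}_{ab} y^{qp}_{cd}` in `𝔻S`. -/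
def cycle (p q : Fin k) (a : Fin (n q)) (b : Fin (n p)) (c : Fin (n p)) (d : Fin (n q)) :
    DS K (S K n) :=
  DS.gen K (S K n) (arrow K n p q a b) * DS.gen K (S K n) (arrow K n q p c d)

end Semisimple

end DoublePoisson

/-!
The gauge element `E : x ↦ 1 ⊗ x - x ⊗ 1` makes the bracket computable. All double derivations
involved are inner, `y^{ij}_{uv} = e^i_{1v} E e^j_{u1}`, so that `P = h E g E k` with
`h = e^p_{1b}`, `g = e^q_{ad}` and `k = e^p_{c1}` (`cycle_eq_word`). Since `{{E, x}} = 1 ⊗ x - x ⊗ 1`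
for every `x` in `𝔻S` (`schouten_gauge`), antisymmetry gives `{P, E} = 0`, and on `S` the odd
derivation `{P, -}` is the commutator with `f E g - g E f`, where `f = k h = e^p_{cb}`
(`bracket_word_incl`). Applying it to `P` and rotating words cyclically,
`{P, P} = -2 (f² E g E g E + f E f E g² E)` modulo graded commutators (`bracket_cycle`).

Here `f² = 0` when `b ≠ c` and `g² = 0` when `a ≠ d`, while `f E f = 0` when `S_p = K` and
`g E g = 0` when `S_q = K`. This yields every case where `{P, P}` vanishes.

For the other cases, the block diagonal representation `ρ` of `S` extends to `𝔻S` by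
`δ ↦ ρ(δ(x)'') T ρ(δ(x)')` for any `x` in `S` and any matrix `T` (`evalHom`), and sends `E` to
`X = [ρ(x), T]`. A graded commutator of odd degree is a plain commutator, because one of its factors
has even degree; hence the trace of the odd part kills all graded commutators
(`trace_sub_parity_of_mem_commutators`). On the two words above it gives cubic monomials in entries
of `X`. If `S_p ≠ K`, then `exists_commutator_entries` finds `x` and `T` for which the monomial of
`f E f E g² E` is `1` and the other is `0`; if `S_q ≠ K`, it does so with the roles exchanged.

The induced bracket takes the value `f ⊗ g - g ⊗ f` on the central idempotents of `S_p` and `S_q`.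
-/

namespace DoublePoisson

/-! ### The gauge element -/

section Gauge

variable {K A : Type*} [Field K] [Ring A] [Algebra K A]

variable (K A) in
/-- The gauge element, the inner double derivation `x ↦ 1 ⊗ x - x ⊗ 1`; it generates all inner
double derivations as a bimodule. -/
def gauge : DoubleDer K A := innerDer 1

theorem gauge_apply (x : A) : (gauge K A).1 x = 1 ⊗ₜ[K] x - x ⊗ₜ[K] 1 := by
  rw [gauge, innerDer_apply, one_mul, mul_one]

theorem innerDer_tmul (s t : A) :
    innerDer (t ⊗ₜ[K] s) = innerL K A s (innerR K A t (gauge K A)) := by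
  ext x
  simp [innerDer_apply, gauge_apply, mul_sub, sub_mul]

theorem gen_innerDer_tmul (s t : A) : DS.gen K A (innerDer (t ⊗ₜ[K] s))
    = DS.incl K A s * DS.gen K A (gauge K A) * DS.incl K A t := by
  rw [innerDer_tmul, DS.gen_innerL, DS.gen_innerR, mul_assoc]

variable [Module.Finite K A]

theorem schoutenR_gauge_left (Δ : DoubleDer K A) : schoutenR (gauge K A) Δ = 1 ⊗ₜ[K] Δ := by
  apply evR_injective
  ext x
  have e1 : ∀ w : A ⊗[K] A, LinearMap.lTensor A (gauge K A).1 w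
      = TensorProduct.leftComm K A A A (1 ⊗ₜ[K] w)
        - TensorProduct.assoc K A A A (w ⊗ₜ[K] 1) := by
    intro w
    induction w using TensorProduct.induction_on with
    | zero => simp
    | add u v hu hv =>
      simp only [map_add, TensorProduct.tmul_add, TensorProduct.add_tmul, hu, hv]; abel
    | tmul u v => simp [gauge_apply, TensorProduct.tmul_sub]
  simp [evR_schoutenR, rMap, rTilde, e1, gauge_apply, DoubleDer.map_one, leftComm_leftComm]

theorem schoutenR_gauge_right (Δ : DoubleDer K A) : schoutenR Δ (gauge K A) = 1 ⊗ₜ[K] Δ := by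
  apply evR_injective
  ext x
  have e1 : ∀ w : A ⊗[K] A,
      TensorProduct.assoc K A A A (LinearMap.rTensor A (gauge K A).1 w)
      = 1 ⊗ₜ[K] w - TensorProduct.leftComm K A A A (1 ⊗ₜ[K] w) := by
    intro w
    induction w using TensorProduct.induction_on with
    | zero => simp
    | add u v hu hv => simp only [map_add, TensorProduct.tmul_add, hu, hv]; abel
    | tmul u v => simp [gauge_apply, TensorProduct.sub_tmul]
  simp [evR_schoutenR, rMap, rTilde, e1, gauge_apply, DoubleDer.map_one, leftComm_leftComm]

/-- The bracket with the gauge element is the outer derivation `x ↦ 1 ⊗ x - x ⊗ 1` on all of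
`𝔻A`: both sides are outer derivations that agree on generators. -/
theorem schouten_gauge (x : DS K A) :
    schouten K A (DS.gen K A (gauge K A)) x = 1 ⊗ₜ[K] x - x ⊗ₜ[K] 1 := by
  have h1 : IsOuterDer (AlgHom.id K _) (schouten K A (DS.gen K A (gauge K A))) := by
    have := (IsMonomial.gen (gauge K A)).schouten
    rwa [pow_succ, pow_one, parity_mul_parity] at this
  let G : DS K A →ₗ[K] DS K A ⊗[K] DS K A :=
    TensorProduct.mk K _ _ 1 - (TensorProduct.mk K _ _).flip 1
  have h2 : IsOuterDer (AlgHom.id K _) G := fun x y => by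
    simp [G, mul_sub, sub_mul]
  refine DFunLike.congr_fun (h1.eq h2 (fun s => ?_) fun Δ => ?_) x
  · simp [G, schouten_gen_incl, gauge_apply]
  · simp [G, schouten_gen_gen, schoutenL, schoutenR_gauge_left, schoutenR_gauge_right]
    abel

theorem schouten_incl_gauge (s : A) :
    schouten K A (DS.incl K A s) (DS.gen K A (gauge K A))
      = 1 ⊗ₜ[K] DS.incl K A s - DS.incl K A s ⊗ₜ[K] 1 := by
  simp [schouten_incl_gen, gauge_apply]

end Gauge

/-! ### Traces and graded commutators -/

section Commutators

variable {K A : Type*} [Field K] [Ring A] [Algebra K A]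

theorem IsMonomial.mem_degree {n : ℕ} {x : DS K A} (h : IsMonomial n x) : x ∈ degree K A n :=
  Submodule.subset_span h

/-- Graded commutators of elements of which one has even degree are plain commutators. -/
theorem IsMonomial.commutator_mem {m n : ℕ} {x y : DS K A} (hx : IsMonomial m x)
    (hy : IsMonomial n y) (h : Even (m * n)) : x * y - y * x ∈ commutators K A :=
  Submodule.subset_span ⟨m, n, x, hx.mem_degree, y, hy.mem_degree, by rw [h.neg_one_pow, one_smul]⟩

theorem parity_of_mem_degree {n : ℕ} {x : DS K A} (h : x ∈ degree K A n) :
    DS.parity K A x = (-1 : K) ^ n • x := by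
  induction h using Submodule.span_induction with
  | zero => simp
  | add x y _ _ h1 h2 => rw [map_add, h1, h2, smul_add]
  | smul r x _ h1 => rw [map_smul, h1, smul_comm]
  | mem a ha => exact ha.parity

/-- A trace on an algebra to which `𝔻A` maps vanishes on the odd parts of graded commutators: a
graded commutator of odd degree has a factor of even degree, so that it is a plain commutator. -/
theorem trace_sub_parity_of_mem_commutators {R : Type*} [Ring R] [Algebra K R]
    (φ : DS K A →ₐ[K] R) (t : R →ₗ[K] K) (ht : ∀ x y, t (x * y) = t (y * x)) {z : DS K A}
    (hz : z ∈ commutators K A) : t (φ (z - DS.parity K A z)) = 0 := by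
  induction hz using Submodule.span_induction with
  | zero => simp
  | add x y _ _ h1 h2 => rw [map_add, add_sub_add_comm, map_add, map_add, h1, h2, add_zero]
  | smul r x _ h1 => rw [map_smul, ← smul_sub, map_smul, map_smul, h1, smul_zero]
  | mem z hz =>
    obtain ⟨m, n, a, ha, b, hb, rfl⟩ := hz
    simp only [map_sub, map_smul, map_mul, parity_of_mem_degree ha, parity_of_mem_degree hb,
      smul_mul_smul_comm, ht (φ b) (φ a), smul_eq_mul]
    rcases m.even_or_odd with hm | hm <;> rcases n.even_or_odd with hn | hn <;>
      simp [hm.neg_one_pow, hn.neg_one_pow, pow_mul]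

end Commutators

/-! ### Brackets of words with two gauge elements -/

section Bracket

variable {K A : Type*} [Field K] [Ring A] [Algebra K A]

theorem mul'_tmul_one_mul (x : DS K A) (z : DS K A ⊗[K] DS K A) :
    LinearMap.mul' K (DS K A) ((x ⊗ₜ[K] 1) * z) = x * LinearMap.mul' K (DS K A) z := by
  induction z using TensorProduct.induction_on with
  | zero => simp
  | tmul u v => simp [mul_assoc]
  | add u v hu hv => simp only [mul_add, map_add, hu, hv]

theorem mul'_mul_one_tmul (x : DS K A) (z : DS K A ⊗[K] DS K A) :
    LinearMap.mul' K (DS K A) (z * (1 ⊗ₜ[K] x)) = LinearMap.mul' K (DS K A) z * x := by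
  induction z using TensorProduct.induction_on with
  | zero => simp
  | tmul u v => simp [mul_assoc]
  | add u v hu hv => simp only [add_mul, map_add, hu, hv]

/-- The element `h E g E k` of degree `2`, where `E` is the gauge element. -/
def word (h g k : A) : DS K A :=
  DS.incl K A h * (DS.gen K A (gauge K A) * (DS.incl K A g *
    (DS.gen K A (gauge K A) * DS.incl K A k)))

theorem isMonomial_word (h g k : A) : IsMonomial 2 (word (K := K) h g k) :=
  (IsMonomial.incl h).mul ((IsMonomial.gen _).mul ((IsMonomial.incl g).mul
    ((IsMonomial.gen _).mul (IsMonomial.incl k))))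

variable [Module.Finite K A]

theorem bracket_mul_right {m n : ℕ} {a b : DS K A} (ha : a ∈ degree K A m)
    (hb : b ∈ degree K A n) (c : DS K A) : bracket K A a (b * c)
      = (-1 : K) ^ ((m + 1) * n) • (b * bracket K A a c) + bracket K A a b * c := by
  rw [bracket, schouten_mul_right ha hb, map_add, map_smul, mul'_tmul_one_mul,
    mul'_mul_one_tmul]
  rfl

/-- The values of `{{s, -}}` on words, from the derivation property and
`{{s, E}} = 1 ⊗ s - s ⊗ 1`. -/
theorem schouten_incl_word (s h g k : A) : schouten K A (DS.incl K A s) (word h g k)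
    = DS.incl K A h ⊗ₜ[K]
        (DS.incl K A s * DS.incl K A g * DS.gen K A (gauge K A) * DS.incl K A k)
      - (DS.incl K A h * DS.incl K A s) ⊗ₜ[K]
        (DS.incl K A g * DS.gen K A (gauge K A) * DS.incl K A k)
      - (DS.incl K A h * DS.gen K A (gauge K A) * DS.incl K A g) ⊗ₜ[K]
        (DS.incl K A s * DS.incl K A k)
      + (DS.incl K A h * DS.gen K A (gauge K A) * DS.incl K A g * DS.incl K A s) ⊗ₜ[K]
        DS.incl K A k := by
  have di := fun x : A => (IsMonomial.incl (K := K) x).mem_degree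
  have dg := (IsMonomial.gen (gauge K A)).mem_degree
  rw [word, schouten_mul_right (di s) (di h), schouten_mul_right (di s) dg,
    schouten_mul_right (di s) (di g), schouten_mul_right (di s) dg]
  simp only [schouten_incl_incl, schouten_incl_gauge]
  simp [mul_add, mul_sub, sub_mul, mul_assoc]
  abel

variable [CharZero K]

/-- The gauge element is killed by every `{a, -}`: up to sign and parity, `{{a, E}}` is
`1 ⊗ a - a ⊗ 1`, and this multiplies to zero. -/
theorem bracket_gauge_right {n : ℕ} {a : DS K A} (ha : a ∈ degree K A n) :
    bracket K A a (DS.gen K A (gauge K A)) = 0 := by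
  rw [bracket, schouten_antisymm ha (IsMonomial.gen _).mem_degree, schouten_gauge]
  simp [koszulFlip_tmul]

/-- On `A`, the derivation `{h E g E k, -}` is the commutator with `k h E g - g E k h`. -/
theorem bracket_word_incl (h g k s : A) : bracket K A (word h g k) (DS.incl K A s)
    = (DS.incl K A (k * h) * DS.gen K A (gauge K A) * DS.incl K A g
        - DS.incl K A g * DS.gen K A (gauge K A) * DS.incl K A (k * h)) * DS.incl K A s
      - DS.incl K A s * (DS.incl K A (k * h) * DS.gen K A (gauge K A) * DS.incl K A g
        - DS.incl K A g * DS.gen K A (gauge K A) * DS.incl K A (k * h)) := by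
  rw [bracket, schouten_antisymm (isMonomial_word h g k).mem_degree
    (IsMonomial.incl s).mem_degree, schouten_incl_word,
    show (-1 : K) ^ ((2 + 1) * (0 + 1)) = -1 by norm_num]
  simp [koszulFlip_tmul, mul_sub, sub_mul, mul_assoc]
  abel

/-- The derivation `{h E g E k, -}` is odd, kills `E`, and is a commutator on `A`; this determines
`{h E g E k, h E g E k}`. Each of the six resulting words is a cyclic rotation of a word that
vanishes or of one of `(k h)² E g E g E` and `k h E k h E g² E`. -/
theorem bracket_word_self {h g k : A} (hg : h * g = 0) (gh : g * h = 0) (gk : g * k = 0)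
    (kg : k * g = 0) : bracket K A (word h g k) (word h g k)
      + (2 : K) • (DS.incl K A (k * h * (k * h)) * (DS.gen K A (gauge K A) * (DS.incl K A g *
          (DS.gen K A (gauge K A) * (DS.incl K A g * DS.gen K A (gauge K A))))))
      + (2 : K) • (DS.incl K A (k * h) * (DS.gen K A (gauge K A) * (DS.incl K A (k * h) *
          (DS.gen K A (gauge K A) * (DS.incl K A (g * g) * DS.gen K A (gauge K A))))))
      ∈ commutators K A := by
  have di := fun x : A => (IsMonomial.incl (K := K) x)
  have dg := (IsMonomial.gen (gauge K A))
  have hP := (isMonomial_word (K := K) h g k).mem_degree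
  have e1 : bracket K A (word h g k) (word h g k) =
    bracket K A (word h g k) (DS.incl K A h) * (DS.gen K A (gauge K A) * (DS.incl K A g *
      (DS.gen K A (gauge K A) * DS.incl K A k)))
    - DS.incl K A h * (DS.gen K A (gauge K A) * (bracket K A (word h g k) (DS.incl K A g) *
      (DS.gen K A (gauge K A) * DS.incl K A k)))
    + DS.incl K A h * (DS.gen K A (gauge K A) * (DS.incl K A g *
      (DS.gen K A (gauge K A) * bracket K A (word h g k) (DS.incl K A k)))) := by
    conv_lhs => arg 4; rw [word]
    rw [bracket_mul_right hP (di h).mem_degree, bracket_mul_right hP dg.mem_degree,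
      bracket_mul_right hP (di g).mem_degree, bracket_mul_right hP dg.mem_degree,
      bracket_gauge_right hP]
    simp [pow_succ, mul_add]
    abel
  rw [e1, bracket_word_incl, bracket_word_incl, bracket_word_incl]
  -- each of these commutators rotates one of the six words; in `c1` and `c6` the rotated
  -- word vanishes since `k g = 0` and `g h = 0`
  have c1 := (di g).commutator_mem (dg.mul ((di (k * h * h)).mul (dg.mul ((di g).mul
    (dg.mul (di k)))))) (by simp)
  have c2 := ((di (h * k * h)).mul (dg.mul ((di g).mul (dg.mul ((di g).mul dg))))).commutator_mem
    (di k) (by simp)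
  have c3 := ((di h).mul (dg.mul ((di (k * h)).mul (dg.mul ((di (g * g)).mul dg))))).commutator_mem
    (di k) (by simp)
  have c4 := ((di h).mul (dg.mul ((di (g * g)).mul dg))).commutator_mem
    ((di (k * h)).mul (dg.mul (di k))) (by decide)
  have c5 := ((di h).mul (dg.mul ((di g).mul (dg.mul ((di g).mul dg))))).commutator_mem
    (di (k * h * k)) (by simp)
  have c6 := ((di h).mul (dg.mul ((di g).mul (dg.mul ((di (k * k * h)).mul dg))))).commutator_mem
    (di g) (by simp)
  have hc := neg_mem (add_mem (add_mem (add_mem (add_mem (add_mem c1 c2) c3) c4) c5) c6)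
  convert hc using 1
  have z1 : ∀ {x y : A}, x * y = 0 → DS.incl K A x * DS.incl K A y = 0 := fun h => by
    rw [← map_mul, h, map_zero]
  have z2 : ∀ {x y : A}, x * y = 0 → ∀ w, DS.incl K A x * (DS.incl K A y * w) = 0 := fun h w => by
    rw [← mul_assoc, z1 h, zero_mul]
  simp only [map_mul, mul_sub, sub_mul, mul_assoc, z1 hg, z2 hg, z1 gh, z2 gh, z1 gk, z2 gk, z1 kg,
    z2 kg, mul_zero, zero_mul, two_smul]
  abel

end Bracket

/-! ### Representations of `𝔻A` -/

section Representations

variable {K A R : Type*} [Field K] [Ring A] [Algebra K A] [Ring R] [Algebra K R]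

/-- The linear map `u ⊗ v ↦ ρ(v) T ρ(u)`. -/
def sandwich (ρ : A →ₐ[K] R) (T : R) : A ⊗[K] A →ₗ[K] R :=
  TensorProduct.lift (LinearMap.mk₂ K (fun u v => ρ v * T * ρ u)
    (fun u u' v => by simp [mul_add])
    (fun c u v => by simp)
    (fun u v v' => by simp [add_mul])
    (fun c u v => by simp))

@[simp] theorem sandwich_tmul (ρ : A →ₐ[K] R) (T : R) (u v : A) :
    sandwich ρ T (u ⊗ₜ[K] v) = ρ v * T * ρ u := rfl

/-- The algebra map `𝔻A → R` that extends `ρ : A → R` and sends a double derivation `δ` to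
`ρ(δ(x)'') T ρ(δ(x)')`. Evaluation at `x` turns the inner bimodule structure of `Der(A, A ⊗ A)`
into that of `A ⊗ A`, so every choice of `x` and `T` is allowed. -/
def evalHom (ρ : A →ₐ[K] R) (T : R) (x : A) : DS K A →ₐ[K] R :=
  DS.lift ρ (sandwich ρ T ∘ₗ LinearMap.applyₗ x ∘ₗ (DoubleDer K A).subtype)
    (fun s δ => by
      simp only [LinearMap.comp_apply, Submodule.subtype_apply, LinearMap.applyₗ_apply_apply,
        innerL_apply]
      generalize δ.1 x = z
      induction z using TensorProduct.induction_on with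
      | zero => simp
      | tmul u v => simp [mul_assoc]
      | add u v hu hv => simp only [mul_add, map_add, hu, hv])
    (fun δ t => by
      simp only [LinearMap.comp_apply, Submodule.subtype_apply, LinearMap.applyₗ_apply_apply,
        innerR_apply]
      generalize δ.1 x = z
      induction z using TensorProduct.induction_on with
      | zero => simp
      | tmul u v => simp [mul_assoc]
      | add u v hu hv => simp only [add_mul, map_add, hu, hv])

@[simp] theorem evalHom_incl (ρ : A →ₐ[K] R) (T : R) (x s : A) :
    evalHom ρ T x (DS.incl K A s) = ρ s := DS.lift_incl _ _ _ _ s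

@[simp] theorem evalHom_gauge (ρ : A →ₐ[K] R) (T : R) (x : A) :
    evalHom ρ T x (DS.gen K A (gauge K A)) = ρ x * T - T * ρ x :=
  (DS.lift_gen _ _ _ _ _).trans (by simp [gauge_apply])

end Representations

/-! ### Matrix units and block diagonal matrices -/

section Semisimple

variable {K : Type*} [Field K] {k : ℕ} {n : Fin k → ℕ}

theorem unit_mul_unit_same (i : Fin k) (u v w z : Fin (n i)) :
    unit K n i u v * unit K n i w z = if v = w then unit K n i u z else 0 := by
  rw [unit, unit, ← Pi.single_mul]
  split_ifs with h
  · subst h; simp [unit]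
  · simp [h]

theorem unit_mul_unit_of_ne {i j : Fin k} (h : i ≠ j) (u v : Fin (n i)) (w z : Fin (n j)) :
    unit K n i u v * unit K n j w z = 0 := by
  funext l
  by_cases hl : l = i
  · subst hl; simp [unit, h]
  · simp [unit, hl]

variable (K n) in
/-- The representation of `S` by block diagonal matrices of size `n₁ + ⋯ + n_k`. -/
def blockRep : S K n →ₐ[K] Matrix (Σ i, Fin (n i)) (Σ i, Fin (n i)) K :=
  AlgHom.ofLinearMap
    { toFun := Matrix.blockDiagonal'
      map_add' := Matrix.blockDiagonal'_add
      map_smul' := Matrix.blockDiagonal'_smul }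
    Matrix.blockDiagonal'_one Matrix.blockDiagonal'_mul

theorem blockRep_unit (i : Fin k) (u v : Fin (n i)) :
    blockRep K n (unit K n i u v) = Matrix.single ⟨i, u⟩ ⟨i, v⟩ 1 := by
  change Matrix.blockDiagonal' (unit K n i u v) = _
  rw [unit]
  ext ⟨j, x⟩ ⟨l, y⟩
  by_cases hj : i = j
  · subst hj
    by_cases hl : i = l
    · subst hl
      simp [Matrix.blockDiagonal'_apply_eq, Matrix.single_apply]
    · simp [Matrix.blockDiagonal'_apply_ne _ _ _ hl, hl]
  · rw [Matrix.single_apply, if_neg (by simp [hj])]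
    by_cases hl : j = l
    · subst hl
      simp [Matrix.blockDiagonal'_apply_eq, Ne.symm hj]
    · simp [Matrix.blockDiagonal'_apply_ne _ _ _ hl]

theorem trace_single_words {ι : Type*} [Fintype ι] [DecidableEq ι] (X : Matrix ι ι K)
    (i j l m r s : ι) :
    Matrix.trace (Matrix.single i j 1 * (X * (Matrix.single l m 1 * (X *
      (Matrix.single r s 1 * X))))) = X j l * X m r * X s i := by
  have h : Matrix.single i j (1 : K) * (X * (Matrix.single l m 1 * (X * (Matrix.single r s 1 * X))))
      = Matrix.single i s (X j l * X m r) * X := by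
    simp only [← mul_assoc]
    rw [Matrix.single_mul_mul_single, Matrix.single_mul_mul_single]
    simp
  rw [h, Matrix.trace_single_mul, smul_eq_mul]

variable [∀ i, NeZero (n i)]

theorem gen_arrow (i j : Fin k) (u : Fin (n j)) (v : Fin (n i)) :
    DS.gen K (S K n) (arrow K n i j u v) = DS.incl K (S K n) (unit K n i 0 v)
      * DS.gen K (S K n) (gauge K (S K n)) * DS.incl K (S K n) (unit K n j u 0) :=
  gen_innerDer_tmul _ _

/-- The two inner matrix units of `P` multiply to `e^q_{ad}`. -/
theorem cycle_eq_word (p q : Fin k) (a : Fin (n q)) (b : Fin (n p)) (c : Fin (n p))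
    (d : Fin (n q)) : cycle K n p q a b c d
      = word (unit K n p 0 b) (unit K n q a d) (unit K n p c 0) := by
  have h : unit K n q a d = unit K n q a 0 * unit K n q 0 d := by simp [unit_mul_unit_same]
  rw [cycle, gen_arrow, gen_arrow, word, h, map_mul]
  simp only [mul_assoc]

end Semisimple

/-! ### Cycles of length two -/

section Cycles

variable {K : Type*} [Field K] {k : ℕ} {n : Fin k → ℕ}

theorem blockRep_mul_apply (x : S K n) (T : Matrix (Σ i, Fin (n i)) (Σ i, Fin (n i)) K)
    (p : Fin k) (b : Fin (n p)) (j : Σ i, Fin (n i)) :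
    (blockRep K n x * T) ⟨p, b⟩ j = ∑ w, x p b w * T ⟨p, w⟩ j := by
  have h : blockRep K n x = Matrix.blockDiagonal' x := rfl
  rw [h, Matrix.mul_apply, Fintype.sum_sigma, Finset.sum_eq_single p]
  · simp [Matrix.blockDiagonal'_apply_eq]
  · intro i _ hi
    simp [Matrix.blockDiagonal'_apply_ne _ _ _ hi.symm]
  · simp

theorem mul_blockRep_apply (x : S K n) (T : Matrix (Σ i, Fin (n i)) (Σ i, Fin (n i)) K)
    (p : Fin k) (c : Fin (n p)) (j : Σ i, Fin (n i)) :
    (T * blockRep K n x) j ⟨p, c⟩ = ∑ w, T j ⟨p, w⟩ * x p w c := by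
  have h : blockRep K n x = Matrix.blockDiagonal' x := rfl
  rw [h, Matrix.mul_apply, Fintype.sum_sigma, Finset.sum_eq_single p]
  · simp [Matrix.blockDiagonal'_apply_eq]
  · intro i _ hi
    simp [Matrix.blockDiagonal'_apply_ne _ _ _ hi]
  · simp

/-- The image `[ρ(x), T]` of the gauge element can have any prescribed entries outside the diagonal
blocks; inside a diagonal block only the trace is constrained, which leaves every single entry
free as soon as the block has size at least `2`. -/
theorem exists_commutator_entries {p q : Fin k} (hpq : p ≠ q) (hp : n p ≠ 1) (a d : Fin (n q))
    (b c : Fin (n p)) : ∃ (x : S K n) (T : Matrix (Σ i, Fin (n i)) (Σ i, Fin (n i)) K),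
      (blockRep K n x * T - T * blockRep K n x) ⟨p, b⟩ ⟨q, a⟩ = 1 ∧
      (blockRep K n x * T - T * blockRep K n x) ⟨q, d⟩ ⟨p, c⟩ = 1 ∧
      (blockRep K n x * T - T * blockRep K n x) ⟨p, b⟩ ⟨p, c⟩ = 1 ∧
      (blockRep K n x * T - T * blockRep K n x) ⟨q, d⟩ ⟨q, a⟩ = 0 := by
  have : Nontrivial (Fin (n p)) := Fin.nontrivial_iff_two_le.2 (by have := b.pos; omega)
  obtain ⟨v, hv⟩ := exists_ne b
  have hcc : ¬ (b = c ∧ v = c) := fun h => hv (h.2.trans h.1.symm)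
  -- the commutator of `e_{bv}` and `e_{vc}` produces the entry at `(b, c)`, and the idempotent of
  -- the `p`-th summand produces the entries outside the diagonal blocks
  refine ⟨Pi.single p (1 + Matrix.single b v 1), Matrix.single ⟨p, b⟩ ⟨q, a⟩ 1
    - Matrix.single ⟨q, d⟩ ⟨p, c⟩ 1 + Matrix.single ⟨p, v⟩ ⟨p, c⟩ 1, ?_, ?_, ?_, ?_⟩
  · rw [Matrix.sub_apply, blockRep_mul_apply, mul_blockRep_apply]
    simp [Matrix.single_apply, Matrix.one_apply, hpq, hpq.symm, hv]
  · rw [Matrix.sub_apply, blockRep_mul_apply, mul_blockRep_apply,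
      Finset.sum_eq_zero (fun w _ => by simp [hpq.symm]), Finset.sum_eq_single c]
    · simp [hpq, hpq.symm, hcc]
    · intro w _ hw
      simp [Matrix.single_apply, hpq.symm, hw.symm]
    · simp
  · rw [Matrix.sub_apply, blockRep_mul_apply, mul_blockRep_apply]
    simp [Matrix.single_apply, Matrix.one_apply, hpq.symm, mul_add, hv, hv.symm]
  · rw [Matrix.sub_apply, blockRep_mul_apply, mul_blockRep_apply]
    simp [hpq.symm]

theorem unit_mul_of_eq_one {i : Fin k} (hi : n i = 1) (u v : Fin (n i)) (x : S K n) :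
    unit K n i u v * x = x i u v • unit K n i u v := by
  have : Subsingleton (Fin (n i)) := by rw [hi]; infer_instance
  funext l
  by_cases hl : l = i
  · subst hl
    ext r s
    obtain rfl := Subsingleton.elim r u
    obtain rfl := Subsingleton.elim s r
    obtain rfl := Subsingleton.elim v s
    simp [unit]
  · simp [unit, hl]

theorem mul_unit_of_eq_one {i : Fin k} (hi : n i = 1) (u v : Fin (n i)) (x : S K n) :
    x * unit K n i u v = x i u v • unit K n i u v := by
  have : Subsingleton (Fin (n i)) := by rw [hi]; infer_instance
  funext l
  by_cases hl : l = i
  · subst hl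
    ext r s
    obtain rfl := Subsingleton.elim r u
    obtain rfl := Subsingleton.elim s r
    obtain rfl := Subsingleton.elim v s
    simp [unit]
  · simp [unit, hl]

/-- When `S_i = K`, a gauge element between two copies of the unit of `S_i` vanishes: `e ⊗ e` with
`e = e^i_{11}` has trivial inner double derivation, so the vertex `i` carries no loop. -/
theorem incl_gauge_incl_of_eq_one {i : Fin k} (hi : n i = 1) (u v : Fin (n i)) (w : DS K (S K n)) :
    DS.incl K (S K n) (unit K n i u v) * (DS.gen K (S K n) (gauge K (S K n))
      * (DS.incl K (S K n) (unit K n i u v) * w)) = 0 := by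
  have h : innerDer (unit K n i u v ⊗ₜ[K] unit K n i u v) = 0 := by
    ext1
    refine LinearMap.ext fun x => ?_
    rw [innerDer_apply, Algebra.TensorProduct.tmul_mul_tmul, Algebra.TensorProduct.tmul_mul_tmul,
      unit_mul_of_eq_one hi u v x, mul_unit_of_eq_one hi u v x, mul_one, one_mul,
      TensorProduct.smul_tmul, sub_self]
    rfl
  simp only [← mul_assoc]
  rw [← gen_innerDer_tmul, h, map_zero, zero_mul]

theorem unit_tmul_sub_unit_tmul_ne_zero {p q : Fin k} (hpq : p ≠ q) (c b : Fin (n p)) (a d : Fin (n q)) :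
    unit K n p c b ⊗ₜ[K] unit K n q a d - unit K n q a d ⊗ₜ[K] unit K n p c b ≠ 0 := by
  intro h
  let e : ∀ i, Fin (n i) → Fin (n i) → S K n →ₗ[K] K := fun i u v =>
    Matrix.entryLinearMap K K u v ∘ₗ LinearMap.proj i
  have := congrArg (TensorProduct.lid K K ∘ TensorProduct.map (e p c b) (e q a d)) h
  simp [e, unit, hpq, hpq.symm] at this

variable [∀ i, NeZero (n i)]

/-- The values of the induced bracket on the central idempotents of the two summands. -/
theorem inducedBracket_arrow_single {p q : Fin k} (hpq : p ≠ q) (a : Fin (n q)) (b : Fin (n p))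
    (c : Fin (n p)) (d : Fin (n q)) :
    inducedBracket (arrow K n p q a b) (arrow K n q p c d) (Pi.single p 1) (Pi.single q 1)
      = unit K n p c b ⊗ₜ[K] unit K n q a d - unit K n q a d ⊗ₜ[K] unit K n p c b := by
  have r : ∀ i (u v : Fin (n i)), unit K n i u v * Pi.single i 1 = unit K n i u v := fun i u v => by
    rw [unit, ← Pi.single_mul, mul_one]
  have l : ∀ i (u v : Fin (n i)), Pi.single i 1 * unit K n i u v = unit K n i u v := fun i u v => by
    rw [unit, ← Pi.single_mul, one_mul]
  have r0 : ∀ {i j} (_ : i ≠ j) (u v : Fin (n i)), unit K n i u v * Pi.single j 1 = 0 :=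
    fun {i j} h u v => by
      funext m
      by_cases hm : m = j
      · subst hm; simp [unit, h]
      · simp [hm]
  have l0 : ∀ {i j} (_ : i ≠ j) (u v : Fin (n i)), Pi.single j 1 * unit K n i u v = 0 :=
    fun {i j} h u v => by
      funext m
      by_cases hm : m = j
      · subst hm; simp [unit, h]
      · simp [hm]
  simp [inducedBracket, arrow, innerDer_apply, r, l, r0 hpq, r0 hpq.symm, l0 hpq, l0 hpq.symm,
    crossMul_tmul, unit_mul_unit_same]

variable [CharZero K]

/-- With `f = e^p_{cb}` and `g = e^q_{ad}`, modulo graded commutators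
`{P, P} = -2 (f² E g E g E + f E f E g² E)`. -/
theorem bracket_cycle {p q : Fin k} (hpq : p ≠ q) (a : Fin (n q)) (b : Fin (n p))
    (c : Fin (n p)) (d : Fin (n q)) :
    bracket K (S K n) (cycle K n p q a b c d) (cycle K n p q a b c d)
      + (2 : K) • (DS.incl K (S K n) (unit K n p c b * unit K n p c b)
        * (DS.gen K _ (gauge K _) * (DS.incl K _ (unit K n q a d)
        * (DS.gen K _ (gauge K _) * (DS.incl K _ (unit K n q a d) * DS.gen K _ (gauge K _))))))
      + (2 : K) • (DS.incl K (S K n) (unit K n p c b)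
        * (DS.gen K _ (gauge K _) * (DS.incl K _ (unit K n p c b)
        * (DS.gen K _ (gauge K _) * (DS.incl K _ (unit K n q a d * unit K n q a d)
        * DS.gen K _ (gauge K _))))))
      ∈ commutators K (S K n) := by
  have h : unit K n p c b = unit K n p c 0 * unit K n p 0 b := by simp [unit_mul_unit_same]
  rw [cycle_eq_word, h]
  exact bracket_word_self (unit_mul_unit_of_ne hpq _ _ _ _) (unit_mul_unit_of_ne hpq.symm _ _ _ _)
    (unit_mul_unit_of_ne hpq.symm _ _ _ _) (unit_mul_unit_of_ne hpq _ _ _ _)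

theorem bracket_cycle_mem_of_ne {p q : Fin k} (hpq : p ≠ q) {a : Fin (n q)} {b : Fin (n p)}
    {c : Fin (n p)} {d : Fin (n q)} (had : a ≠ d) (hbc : b ≠ c) :
    bracket K (S K n) (cycle K n p q a b c d) (cycle K n p q a b c d)
      ∈ commutators K (S K n) := by
  have h := bracket_cycle (K := K) hpq a b c d
  simpa [unit_mul_unit_same, had.symm, hbc] using h

theorem bracket_cycle_mem_of_eq_one {p q : Fin k} (hpq : p ≠ q) (hp : n p = 1) (hq : n q = 1)
    (a : Fin (n q)) (b : Fin (n p)) (c : Fin (n p)) (d : Fin (n q)) :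
    bracket K (S K n) (cycle K n p q a b c d) (cycle K n p q a b c d)
      ∈ commutators K (S K n) := by
  have h := bracket_cycle (K := K) hpq a b c d
  simpa [incl_gauge_incl_of_eq_one hp, incl_gauge_incl_of_eq_one hq] using h

/-- The trace obstruction: membership of `{P, P}` in `[𝔻S, 𝔻S]` forces a cubic relation between the
entries of the image `X = [ρ(x), T]` of the gauge element in every representation. -/
theorem entries_of_bracket_cycle_mem {p q : Fin k} (hpq : p ≠ q) {a : Fin (n q)} {b : Fin (n p)}
    {c : Fin (n p)} {d : Fin (n q)}
    (hmem : bracket K (S K n) (cycle K n p q a b c d) (cycle K n p q a b c d)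
      ∈ commutators K (S K n)) (x : S K n) (T X : Matrix (Σ i, Fin (n i)) (Σ i, Fin (n i)) K)
    (hX : blockRep K n x * T - T * blockRep K n x = X) :
    (if b = c then X ⟨p, b⟩ ⟨q, a⟩ * X ⟨q, d⟩ ⟨q, a⟩ * X ⟨q, d⟩ ⟨p, c⟩ else 0)
      + (if a = d then X ⟨p, b⟩ ⟨p, c⟩ * X ⟨p, b⟩ ⟨q, a⟩ * X ⟨q, d⟩ ⟨p, c⟩ else 0) = 0 := by
  have h := sub_mem (bracket_cycle (K := K) hpq a b c d) hmem
  rw [add_assoc, add_sub_cancel_left, ← smul_add, Submodule.smul_mem_iff _ two_ne_zero] at h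
  have ht := trace_sub_parity_of_mem_commutators (evalHom (blockRep K n) T x)
    (Matrix.traceLinearMap _ K K) (fun x y => Matrix.trace_mul_comm x y) h
  -- words with three gauge elements are odd
  have h0 : ∀ z : DS K (S K n), DS.parity K _ z = -z → z - DS.parity K _ z = (2 : K) • z :=
    fun z hz => by rw [hz, two_smul, sub_neg_eq_add]
  rw [h0 _ (by simp; abel), map_smul, map_smul, smul_eq_zero_iff_right two_ne_zero] at ht
  simp only [map_add, map_mul, evalHom_incl, evalHom_gauge, hX,
    unit_mul_unit_same, apply_ite (blockRep K n), map_zero, blockRep_unit, ite_mul, mul_ite,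
    zero_mul, mul_zero, apply_ite (Matrix.traceLinearMap _ K K), eq_comm (a := d)] at ht
  simpa [trace_single_words] using ht

theorem bracket_cycle_notMem_of_left {p q : Fin k} (hpq : p ≠ q) (hp : n p ≠ 1) {a d : Fin (n q)}
    (had : a = d) (b c : Fin (n p)) :
    bracket K (S K n) (cycle K n p q a b c d) (cycle K n p q a b c d)
      ∉ commutators K (S K n) := by
  intro h
  obtain ⟨x, T, h1, h2, h3, h4⟩ := exists_commutator_entries (K := K) hpq hp a d b c
  have := entries_of_bracket_cycle_mem hpq h x T _ rfl
  rw [h1, h2, h3, h4, if_pos had] at this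
  simp at this

theorem bracket_cycle_notMem_of_right {p q : Fin k} (hpq : p ≠ q) (hq : n q ≠ 1) (a d : Fin (n q))
    {b c : Fin (n p)} (hbc : b = c) :
    bracket K (S K n) (cycle K n p q a b c d) (cycle K n p q a b c d)
      ∉ commutators K (S K n) := by
  intro h
  obtain ⟨x, T, h1, h2, h3, h4⟩ := exists_commutator_entries (K := K) hpq.symm hq c b d a
  have := entries_of_bracket_cycle_mem hpq h x T _ rfl
  rw [h1, h2, h3, h4, if_pos hbc] at this
  simp at this

end Cycles

end DoublePoisson

theorem mainTheorem5 {K : Type*} [Field K] [IsAlgClosed K] [CharZero K] {k : ℕ} (n : Fin k → ℕ)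
    [∀ i, NeZero (n i)] (p q : Fin k) (hpq : p ≠ q)
    (a : Fin (n q)) (b : Fin (n p)) (c : Fin (n p)) (d : Fin (n q)) :
    (n p ≠ 1 → n q ≠ 1 →
      (DoublePoisson.bracket K (DoublePoisson.S K n) (DoublePoisson.cycle K n p q a b c d)
          (DoublePoisson.cycle K n p q a b c d)
          ∈ DoublePoisson.commutators K (DoublePoisson.S K n) ↔
        ((a : ℤ) - (d : ℤ)) * ((b : ℤ) - (c : ℤ)) ≠ 0)) ∧
    (n p ≠ 1 → n q = 1 →
      (DoublePoisson.bracket K (DoublePoisson.S K n) (DoublePoisson.cycle K n p q a b c d)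
          (DoublePoisson.cycle K n p q a b c d)
          ∈ DoublePoisson.commutators K (DoublePoisson.S K n) ↔ (a : ℤ) - (d : ℤ) ≠ 0)) ∧
    (n p = 1 → n q ≠ 1 →
      (DoublePoisson.bracket K (DoublePoisson.S K n) (DoublePoisson.cycle K n p q a b c d)
          (DoublePoisson.cycle K n p q a b c d)
          ∈ DoublePoisson.commutators K (DoublePoisson.S K n) ↔ (b : ℤ) - (c : ℤ) ≠ 0)) ∧
    (n p = 1 → n q = 1 →
      DoublePoisson.bracket K (DoublePoisson.S K n) (DoublePoisson.cycle K n p q a b c d)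
          (DoublePoisson.cycle K n p q a b c d)
        ∈ DoublePoisson.commutators K (DoublePoisson.S K n)) ∧
    ∃ x y : DoublePoisson.S K n,
      DoublePoisson.inducedBracket (DoublePoisson.arrow K n p q a b)
        (DoublePoisson.arrow K n q p c d) x y ≠ 0 := by
  open DoublePoisson in
  have cast_sub : ∀ {m : ℕ} (u v : Fin m), (u : ℤ) - (v : ℤ) ≠ 0 ↔ u ≠ v := fun u v => by
    rw [sub_ne_zero, Nat.cast_injective.ne_iff, Fin.val_injective.ne_iff]
  refine ⟨fun hp hq => ?_, fun hp hq => ?_, fun hp hq => ?_,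
    fun hp hq => bracket_cycle_mem_of_eq_one hpq hp hq a b c d,
    Pi.single p 1, Pi.single q 1, ?_⟩
  · rw [mul_ne_zero_iff, cast_sub, cast_sub]
    exact ⟨fun h => ⟨fun had => bracket_cycle_notMem_of_left hpq hp had b c h,
      fun hbc => bracket_cycle_notMem_of_right hpq hq a d hbc h⟩,
      fun h => bracket_cycle_mem_of_ne hpq h.1 h.2⟩
  · have : Subsingleton (Fin (n q)) := by rw [hq]; infer_instance
    have had : a = d := Subsingleton.elim a d
    rw [cast_sub]
    exact iff_of_false (bracket_cycle_notMem_of_left hpq hp had b c) fun h => h had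
  · have : Subsingleton (Fin (n p)) := by rw [hp]; infer_instance
    have hbc : b = c := Subsingleton.elim b c
    rw [cast_sub]
    exact iff_of_false (bracket_cycle_notMem_of_right hpq hq a d hbc) fun h => h hbc
  · rw [inducedBracket_arrow_single hpq]
    exact unit_tmul_sub_unit_tmul_ne_zero hpq c b a d
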